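/- Let $L$ be a field, $\sigma$ an automorphism of $L$ of finite order $n$ with fixed field $K$, let $K'\le K$ be a subfield with $[K:K']<\infty$, and $\rho$ an automorphism of $L$ over $K'$. Let $R=L[x;\sigma]$ be the skew polynomial ring ($xa=a^{\sigma}x$ for $a\in L$). For a monic irreducible $F\in K[y]$ of degree $s$, with constant term $F_0$, put $E_F=K[y]/(F)$ and $R_F=R/RF(x^n)$; for $\eta\in L$ and $1\le k\le n$ put $$S_{n,s,k}(\eta,\rho,F)=\{a+RF(x^n): a=\textstyle\sum_i a_ix^i\in R,\ \deg a\le ks,\ a_{ks}=\eta a_0^{\rho}\}\subseteq R_F .$$ Say that the norm condition holds for $(k,\eta,F)$ if $N_{L:K'}(\eta)\,N_{K:K'}\big((-1)^{sk(n-1)}F_0^k\big)\neq 1$. 1. If the norm condition holds and $R_F\cong M_n(E_F)$ as $K$-algebras, then under every such isomorphism $S_{n,s,k}(\eta,\rho,F)$ becomes a $K'$-linear MRD code with minimum distance $d=n-k+1$; that is, a $K'$-subspace of $M_n(E_F)$ of dimension $n(n-d+1)[E_F:K']$ in which the least rank of a difference of two distinct elements is exactly $d$. 2. If $L$ is finite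 and $|K|=q$, then $R_F\cong M_n(E_F)$ whenever $F\ne y$ or $n=1$, and $|S_{n,s,k}(\eta,\rho,F)|=q^{nsk}$ whenever the norm condition holds. 3. Let $k=1$, let the norm condition hold, and identify $R_F$ with $M_n(E_F)$ by a $K$-algebra isomorphism. Then $S_{n,s,1}(\eta,\rho,F)$ defines semifields: it is the image of an injective $K'$-linear map $\psi:E_F^n\to M_n(E_F)$, and for each such $\psi$ the product $u\circ v=\psi(u)v$ makes $E_F^n$ a presemifield over $K'$ (a not necessarily associative division algebra, with $a\circ x=b$ and $y\circ a=b$ uniquely solvable for $a\neq0$), isotopic to a semifield over $K'$ (a presemifield with identity). 4. (Cyclic semifields.) For $f\in R$ irreducible of degree $s$ let $\mathbb S_f$ be the set of $a\in R$ with $\deg a<s$, with $a\circ b$ the remainder of $ab$ on right division by $f$. Let $k=1$, $\eta=0$; the norm condition then holds for every $F$. If $f$ is irreducible of degree $s=\deg F$ and a right divisor of $F(x^n)$, then under every $K$-algebra isomorphism $R_F\cong M_n(E_F)$ the set $S_{n,s,1}(0,\rho,F)$ is the spread set $\{b\mapsto a\circ b\}$ of $\mathbb S_f$, after an additive identification of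 $\mathbb S_f$ with $E_F^n$. If $L$ is finite, then for every irreducible $f\in R$ of degree $s$ there is a monic irreducible $F\neq y$ in $K[y]$ of degree $s$ such that $S_{n,s,1}(0,\rho,F)$ is, in this sense, the spread set of $\mathbb S_f$. 5. (Twisted Gabidulin codes.) Let $s=1$, $F=y-1$. Then $\sum a_ix^i\mapsto\big(b\mapsto\sum a_ib^{\sigma^i}\big)$ induces a $K$-algebra isomorphism $R_{y-1}\cong\mathrm{End}_K(L)$, which maps $S_{n,1,k}(\eta,\rho,y-1)$ onto the generalised twisted Gabidulin code $$\{f_0X+f_1X^{\sigma}+\cdots+f_{k-1}X^{\sigma^{k-1}}+\eta f_0^{\rho}X^{\sigma^k}:f_i\in L\},$$ and the norm condition reads $N_{L:K'}(\eta)\ne(-1)^{nk[K:K']}$. 6. (Generalised twisted fields.) In 5 with $k=1$, the image of $S_{n,1,1}(\eta,\rho,y-1)$ is the spread set $\{b\mapsto a\circ b:a\in L\}$ of the multiplication $a\circ b=ab-(-\eta)a^{\rho}b^{\sigma}$ on $L$, and the norm condition reads $N_{L:K'}(-\eta)\neq1$. Moreover every generalised twisted field arises: if $i,j\ge0$ and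 $c\in L$ with $N_{L:K}(c)\ne1$, let $\tau=\sigma^j$, let $K_1$ be its fixed field and $n_1$ its order; then the norm condition holds for $S_{n_1,1,1}(-c,\sigma^i,y-1)\subseteq L[x;\tau]/(x^{n_1}-1)\cong\mathrm{End}_{K_1}(L)$ (with $K$ and $K_1$ in the roles of $K'$ and $K$), and this set is the spread set of $a\circ b=ab-c\,a^{\sigma^i}b^{\sigma^j}$. -/

import Mathlib

open Polynomial

noncomputable section

namespace SkewMRD

/-! ### The skew polynomial ring `L[x;σ]` -/

section Ring

variable {K L : Type*} [Field K] [Field L] [Algebra K L]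

/-- A copy of the field `L` that remembers the automorphism `σ`; it is the coefficient ring of
`L[x;σ]`. -/
def Twist (_σ : L ≃ₐ[K] L) : Type _ := L

instance (σ : L ≃ₐ[K] L) : Field (Twist σ) := inferInstanceAs (Field L)

instance (σ : L ≃ₐ[K] L) : Algebra K (Twist σ) := inferInstanceAs (Algebra K L)

/-- `x` acts on the coefficients by `σ`, hence `x ^ m` acts by `σ ^ m`. -/
instance (σ : L ≃ₐ[K] L) : MulSemiringAction (Multiplicative ℕ) (Twist σ) where
  smul m a := ((σ ^ Multiplicative.toAdd m) (a : L) : L)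
  one_smul a := by
    change ((σ ^ 0) (a : L) : L) = a
    rw [pow_zero]; rfl
  mul_smul m m' a := by
    change ((σ ^ (Multiplicative.toAdd m + Multiplicative.toAdd m')) (a : L) : L) =
      (σ ^ Multiplicative.toAdd m) ((σ ^ Multiplicative.toAdd m') (a : L))
    rw [pow_add]; rfl
  smul_zero m := map_zero (σ ^ Multiplicative.toAdd m)
  smul_add m := map_add (σ ^ Multiplicative.toAdd m)
  smul_one m := map_one (σ ^ Multiplicative.toAdd m)
  smul_mul m := map_mul (σ ^ Multiplicative.toAdd m)

instance (σ : L ≃ₐ[K] L) : SMulCommClass (Multiplicative ℕ) K (Twist σ) where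
  smul_comm m c a := map_smul (σ ^ Multiplicative.toAdd m) c (a : L)

/-- The skew polynomial ring `R = L[x;σ]`, in which `x * a = σ a * x` for `a ∈ L`. -/
abbrev SkewPoly (σ : L ≃ₐ[K] L) : Type _ := SkewPolynomial (Twist σ)

/-- The coefficient of `x ^ i`, as an element of `L`. -/
def coeff {σ : L ≃ₐ[K] L} (p : SkewPoly σ) (i : ℕ) : L := SkewPolynomial.coeff p i

/-- The constant skew polynomial `a`. -/
def const (σ : L ≃ₐ[K] L) (a : L) : SkewPoly σ := SkewPolynomial.C (R := Twist σ) a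

theorem X_mul_const (σ : L ≃ₐ[K] L) (a : L) :
    (SkewPolynomial.X : SkewPoly σ) * const σ a = const σ (σ a) * SkewPolynomial.X := by
  have h : ∀ b : Twist σ, (SkewPolynomial.X : SkewPoly σ) * SkewPolynomial.C b =
      SkewPolynomial.C (SkewPolynomial.φ b) * SkewPolynomial.X := by
    intro b
    rw [← SkewPolynomial.monomial_zero_left, ← SkewPolynomial.monomial_zero_left,
      SkewPolynomial.X_mul_monomial, SkewPolynomial.monomial_mul_X]
  exact h a

/-- The element `F(x ^ n)` of `L[x;σ]`, where `n` is the order of `σ`. -/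
def evalXPow (σ : L ≃ₐ[K] L) (F : K[X]) : SkewPoly σ :=
  aeval ((SkewPolynomial.X : SkewPoly σ) ^ orderOf σ) F

theorem X_pow_mem_center (σ : L ≃ₐ[K] L) :
    (SkewPolynomial.X : SkewPoly σ) ^ orderOf σ ∈ Subalgebra.center K (SkewPoly σ) := by
  rw [Subalgebra.mem_center_iff]
  intro p
  rw [SkewPolynomial.X_pow_mul]
  have h : ∀ b : Twist σ, (⇑(SkewPolynomial.φ (R := Twist σ)))^[orderOf σ] b = b := by
    intro b
    rw [SkewPolynomial.φ_iterate_apply]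
    change ((σ ^ orderOf σ) (b : L) : L) = b
    rw [pow_orderOf_eq_one]; rfl
  simp only [h, SkewPolynomial.sum_monomial]

theorem evalXPow_mem_center (σ : L ≃ₐ[K] L) (F : K[X]) :
    evalXPow σ F ∈ Subalgebra.center K (SkewPoly σ) := by
  have h : Algebra.adjoin K {(SkewPolynomial.X : SkewPoly σ) ^ orderOf σ} ≤
      Subalgebra.center K (SkewPoly σ) :=
    Algebra.adjoin_le (Set.singleton_subset_iff.mpr (X_pow_mem_center σ))
  exact h (aeval_mem_adjoin_singleton K _)

/-- The ideal `R F(x ^ n)`: a left ideal by construction, and two-sided as `F(x ^ n)` is central. -/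
abbrev centralIdeal (σ : L ≃ₐ[K] L) (F : K[X]) : Ideal (SkewPoly σ) :=
  Ideal.span {evalXPow σ F}

instance (σ : L ≃ₐ[K] L) (F : K[X]) : (centralIdeal σ F).IsTwoSided where
  mul_mem_of_left {a} b ha := by
    obtain ⟨c, rfl⟩ := Ideal.mem_span_singleton'.mp ha
    rw [mul_assoc, ← Subalgebra.mem_center_iff.mp (evalXPow_mem_center σ F) b, ← mul_assoc]
    exact Ideal.mem_span_singleton'.mpr ⟨c * b, rfl⟩

/-- The quotient algebra `R_F = R / R F(x ^ n)`. -/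
abbrev RF (σ : L ≃ₐ[K] L) (F : K[X]) : Type _ := SkewPoly σ ⧸ centralIdeal σ F

/-- The class `a + R F(x ^ n)`. -/
def mk (σ : L ≃ₐ[K] L) (F : K[X]) (a : SkewPoly σ) : RF σ F :=
  Ideal.Quotient.mk (centralIdeal σ F) a

/-- The set `S_{n,s,k}(η,ρ,F)` in `R_F`, where `n` is the order of `σ` and `s = deg F`:
the classes of the `a` with `deg a ≤ k s` and `a_{k s} = η a_0 ^ ρ`. -/
def codeS {K' : Type*} [Field K'] [Algebra K' L] (σ : L ≃ₐ[K] L) (k : ℕ) (η : L)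
    (ρ : L ≃ₐ[K'] L) (F : K[X]) : Set (RF σ F) :=
  {u | ∃ a : SkewPoly σ, (∀ i, k * F.natDegree < i → coeff a i = 0) ∧
    coeff a (k * F.natDegree) = η * ρ (coeff a 0) ∧ u = mk σ F a}

/-- The condition `N_{L:K'}(η) N_{K:K'}((-1)^{s k (n-1)} F_0 ^ k) ≠ 1`. -/
def NormCond (K' : Type*) [Field K'] [Algebra K' K] [Algebra K' L] (σ : L ≃ₐ[K] L) (k : ℕ)
    (η : L) (F : K[X]) : Prop :=
  Algebra.norm K' η *
    Algebra.norm K' ((-1) ^ (F.natDegree * k * (orderOf σ - 1)) * F.coeff 0 ^ k : K) ≠ 1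

end Ring

/-! ### Rank-metric codes -/

section Codes

/-- `C` has minimum (rank) distance `d`: distinct elements are at distance at least `d`, with
equality for some pair. -/
def HasMinDistance {E : Type*} [CommRing E] {n : ℕ} (C : Set (Matrix (Fin n) (Fin n) E))
    (d : ℕ) : Prop :=
  (∀ A ∈ C, ∀ B ∈ C, A ≠ B → d ≤ (A - B).rank) ∧ ∃ A ∈ C, ∃ B ∈ C, A ≠ B ∧ (A - B).rank = d

/-- `C ⊆ M_n(E)` is a `K'`-linear maximum rank distance code with minimum distance `d`: a
`K'`-subspace of dimension `n (n - d + 1) [E : K']`, the value of the Singleton-like bound. -/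
structure IsLinearMRD (K' : Type*) [Field K'] {E : Type*} [CommRing E] [Algebra K' E] {n : ℕ}
    (C : Set (Matrix (Fin n) (Fin n) E)) (d : ℕ) : Prop where
  linear : ∃ W : Submodule K' (Matrix (Fin n) (Fin n) E), (W : Set _) = C ∧
    Module.finrank K' W = n * (n - d + 1) * Module.finrank K' E
  minDistance : HasMinDistance C d

end Codes

/-! ### Semifields -/

section Semifields

/-- A presemifield over `k`: a nonzero (nonassociative) division algebra over `k`. -/
structure IsPresemifield (k : Type*) [Field k] {V : Type*} [AddCommGroup V] [Module k V]
    (mul : V → V → V) : Prop where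
  nontrivial : Nontrivial V
  add_mul : ∀ a b c, mul (a + b) c = mul a c + mul b c
  mul_add : ∀ a b c, mul a (b + c) = mul a b + mul a c
  smul_mul : ∀ (t : k) a b, mul (t • a) b = t • mul a b
  mul_smul : ∀ (t : k) a b, mul a (t • b) = t • mul a b
  left_div : ∀ a, a ≠ 0 → ∀ b, ∃! x, mul a x = b
  right_div : ∀ a, a ≠ 0 → ∀ b, ∃! y, mul y a = b

/-- A semifield is a presemifield with a two-sided identity. -/
structure IsSemifield (k : Type*) [Field k] {V : Type*} [AddCommGroup V] [Module k V]
    (mul : V → V → V) : Prop extends IsPresemifield k mul where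
  exists_one : ∃ e, ∀ a, mul e a = a ∧ mul a e = a

/-- Isotopy: `A (a ∘ b) = B a ∘' C b` for invertible additive maps `A`, `B`, `C`. -/
def Isotopic {V V' : Type*} [AddCommGroup V] [AddCommGroup V'] (mul : V → V → V)
    (mul' : V' → V' → V') : Prop :=
  ∃ A B C : V ≃+ V', ∀ a b, A (mul a b) = mul' (B a) (C b)

/-- The subset `C` of `M_n(E)` defines semifields: it is a `K'`-subspace that can be parametrised
by `E ^ n`, and for every parametrisation `ψ` the product `u ∘ v = ψ(u) v` makes `E ^ n` a
presemifield over `K'`, isotopic to a semifield over `K'`. -/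
def DefinesSemifields (K' : Type*) [Field K'] {E : Type*} [CommRing E] [Algebra K' E] {n : ℕ}
    (C : Set (Matrix (Fin n) (Fin n) E)) : Prop :=
  (∃ ψ : (Fin n → E) →ₗ[K'] Matrix (Fin n) (Fin n) E, Function.Injective ψ ∧ Set.range ψ = C) ∧
  ∀ ψ : (Fin n → E) →ₗ[K'] Matrix (Fin n) (Fin n) E, Function.Injective ψ → Set.range ψ = C →
    IsPresemifield K' (fun u v => (ψ u).mulVec v) ∧
    ∃ mul' : (Fin n → E) → (Fin n → E) → (Fin n → E),
      IsSemifield K' mul' ∧ Isotopic (fun u v => (ψ u).mulVec v) mul'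

/-- `C ⊆ M_n(E)` is the spread set of `(V, mul)`, the set of its left multiplications `M_a`, after
an identification `B` of `V` with `E ^ n`. -/
def IsSpreadSetOf {E : Type*} [CommRing E] {n : ℕ} (C : Set (Matrix (Fin n) (Fin n) E))
    {V : Type*} [AddCommGroup V] (mul : V → V → V) : Prop :=
  ∃ B : V ≃+ (Fin n → E),
    (∀ a, ∃ M ∈ C, ∀ b, M.mulVec (B b) = B (mul a b)) ∧
    ∀ M ∈ C, ∃ a, ∀ b, M.mulVec (B b) = B (mul a b)

variable {K L : Type*} [Field K] [Field L] [Algebra K L]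

/-- Generalised twisted field multiplication `a ∘ b = a b - c a ^ α b ^ β`. -/
def twistedMul (α β : L → L) (c a b : L) : L := a * b - c * α a * β b

/-- The spread set in `End_K(L)` of a multiplication on `L`. -/
def spreadSetEnd (K : Type*) [Field K] [Algebra K L] (mul : L → L → L) :
    Set (Module.End K L) :=
  {g | ∃ a, ∀ b, g b = mul a b}

/-- The generalised twisted Gabidulin code
`{f_0 X + f_1 X ^ σ + ⋯ + f_{k-1} X ^ (σ ^ (k-1)) + η f_0 ^ ρ X ^ (σ ^ k)}` in `End_K(L)`. -/
def twistedGabidulin {K' : Type*} [Field K'] [Algebra K' L] (σ : L ≃ₐ[K] L) (k : ℕ) (η : L)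
    (ρ : L ≃ₐ[K'] L) : Set (Module.End K L) :=
  {g | ∃ c : ℕ → L, ∀ b,
    g b = (∑ i ∈ Finset.range k, c i * (σ ^ i) b) + η * ρ (c 0) * (σ ^ k) b}

/-- `Φ` is the correspondence `∑ a_i x ^ i ↦ ∑ a_i X ^ (σ ^ i)` between `R_{y-1}`, that is
`L[x;σ] / (x ^ n - 1)`, and `End_K(L)`. -/
def IsLinearizedCorrespondence (σ : L ≃ₐ[K] L)
    (Φ : RF σ (X - 1 : K[X]) ≃ₐ[K] Module.End K L) : Prop :=
  ∀ (a : SkewPoly σ) (b : L), Φ (mk σ _ a) b =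
    ∑ i ∈ SkewPolynomial.support a, coeff a i * (σ ^ i) b

/-- The skew polynomial `f` has degree exactly `s`. -/
def HasDegree {σ : L ≃ₐ[K] L} (f : SkewPoly σ) (s : ℕ) : Prop :=
  coeff f s ≠ 0 ∧ ∀ i, s < i → coeff f i = 0

/-- The skew polynomials of degree less than `s`. -/
def degLT (σ : L ≃ₐ[K] L) (s : ℕ) : AddSubgroup (SkewPoly σ) where
  carrier := {p | ∀ i, s ≤ i → coeff p i = 0}
  zero_mem' _ _ := rfl
  add_mem' {p q} hp hq i hi := by
    have h : coeff (p + q) i = coeff p i + coeff q i := SkewPolynomial.coeff_add p q i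
    rw [h, hp i hi, hq i hi, add_zero]
  neg_mem' {p} hp i hi := by
    have h : coeff (-p) i = -coeff p i := SkewPolynomial.coeff_neg p i
    rw [h, hp i hi, neg_zero]

theorem coeff_monomial_mul {σ : L ≃ₐ[K] L} (m : ℕ) (a : L) (f : SkewPoly σ) (i : ℕ) :
    coeff (SkewPolynomial.monomial (R := Twist σ) m a * f) (m + i) = a * (σ ^ m) (coeff f i) := by
  have h := SkewMonoidAlgebra.coeff_single_mul_aux (k := Twist σ) (G := Multiplicative ℕ) f
    (r := a) (x := Multiplicative.ofAdd m) (y := Multiplicative.ofAdd (m + i))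
    (z := Multiplicative.ofAdd i) (by
      intro c
      rw [ofAdd_add]
      exact mul_right_inj (Multiplicative.ofAdd m))
  exact h

/-- Right division with remainder by a skew polynomial of degree `s`. -/
theorem exists_remainder {σ : L ≃ₐ[K] L} {f : SkewPoly σ} {s : ℕ} (hf : HasDegree f s)
    (p : SkewPoly σ) : ∃ r : degLT σ s, p - r ∈ Ideal.span {f} := by
  suffices H : ∀ (N : ℕ) (p : SkewPoly σ), p ∈ degLT σ N →
      ∃ r : degLT σ s, p - r ∈ Ideal.span {f} by
    obtain ⟨N, hN⟩ := (SkewPolynomial.support p).bddAbove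
    refine H (N + 1) p fun i hi => ?_
    by_contra h
    have := hN (Finset.mem_coe.mpr (SkewPolynomial.mem_support_iff.mpr h))
    omega
  intro N
  induction N with
  | zero =>
    intro p hp
    exact ⟨⟨p, fun i _ => hp i (Nat.zero_le i)⟩, by simp⟩
  | succ N ih =>
    intro p hp
    by_cases hN : N < s
    · exact ⟨⟨p, fun i hi => hp i (by omega)⟩, by simp⟩
    · obtain ⟨m, rfl⟩ : ∃ m, N = m + s := ⟨N - s, by omega⟩
      have hlead : (σ ^ m) (coeff f s) ≠ 0 := (map_ne_zero (σ ^ m)).mpr hf.1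
      set c : L := coeff p (m + s) / (σ ^ m) (coeff f s) with hc
      set g : SkewPoly σ := SkewPolynomial.monomial (R := Twist σ) m c with hg
      obtain ⟨r, hr⟩ := ih (p - g * f) (by
        intro i hi
        have hsub : coeff (p - g * f) i = coeff p i - coeff (g * f) i :=
          SkewPolynomial.coeff_sub p (g * f) i
        obtain ⟨j, rfl⟩ : ∃ j, i = m + j := ⟨i - m, by omega⟩
        rw [hsub, hg, coeff_monomial_mul]
        rcases (show s = j ∨ s < j by omega) with rfl | hj
        · rw [hc, div_mul_cancel₀ _ hlead, sub_self]
        · rw [hf.2 j hj, hp (m + j) (by omega)]; simp)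
      refine ⟨r, ?_⟩
      have : p - (r : SkewPoly σ) = (p - g * f - r) + g * f := by abel
      rw [this]
      exact Ideal.add_mem _ hr (Ideal.mem_span_singleton'.mpr ⟨g, rfl⟩)

/-- The multiplication `a ∘ b = a b mod_r f` of the Petit (cyclic) semifield `𝕊_f` on the skew
polynomials of degree less than `s = deg f`, where `mod_r` is the remainder of right division. -/
def petitMul {σ : L ≃ₐ[K] L} {f : SkewPoly σ} {s : ℕ} (hf : HasDegree f s)
    (a b : degLT σ s) : degLT σ s :=
  (exists_remainder hf (a * b : SkewPoly σ)).choose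

theorem petitMul_spec {σ : L ≃ₐ[K] L} {f : SkewPoly σ} {s : ℕ} (hf : HasDegree f s)
    (a b : degLT σ s) :
    (a * b : SkewPoly σ) - petitMul hf a b ∈ Ideal.span {f} :=
  (exists_remainder hf (a * b : SkewPoly σ)).choose_spec

end Semifields

end SkewMRD

end

/-!
The ring `L[x;σ]` is free of rank `n` over `L[y]`, `y = x ^ n`, and the determinant of the
resulting regular representation is a multiplicative norm with values in `K[y]`. The norm of `a`
has degree at most `deg a`, and its coefficients in degrees `0` and `deg a` are, up to sign, the
norms of `a_0` and of the leading coefficient. If `a` represents a matrix of rank at most `n - r`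
in `R_F ≅ M_n(E_F)`, then `F ^ r` divides the norm of `a`. For a nonzero element of the code,
`deg a ≤ k s` thus gives rank at least `n - k`; equality would make the norm of `a` a scalar
multiple of `F ^ k`, and comparing its two extreme coefficients contradicts the norm condition.
Dimensions being known, the code is MRD, and for `k = 1` its nonzero elements are invertible.

A monic element of least degree of a two-sided ideal is, up to a power of `x`, a polynomial in `y`.
Hence `R_F` is central simple over `E_F` when `F ≠ y`, and Wedderburn's theorems on simple rings
and on finite division rings make it a matrix ring when `L` is finite. An irreducible `f` dividing
`F(x ^ n)` yields the module `R / R f` over `R_F`, on which the elements of degree less than `s`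
act as the left multiplications of the cyclic semifield. Finally, the action of `L[x;σ]` on `L`
identifies `R_{y-1}` with `End_K(L)`.
-/

noncomputable section

namespace SkewMRD

/-! ### Coefficients and degrees of skew polynomials -/

section SkewPolyBasic

variable {K L : Type*} [Field K] [Field L] [Algebra K L] {σ : L ≃ₐ[K] L}

/-- The monomial `a x ^ m` of `L[x;σ]`, as a `K`-linear function of `a ∈ L` (and not of
`a ∈ Twist σ`). -/
def mon (σ : L ≃ₐ[K] L) (m : ℕ) : L →ₗ[K] SkewPoly σ where
  toFun a := SkewPolynomial.monomial (R := Twist σ) m a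
  map_add' a b := map_add (SkewPolynomial.monomial (R := Twist σ) m) a b
  map_smul' t a := (SkewPolynomial.smul_monomial (R := Twist σ) m t a).symm

theorem coeff_ext {p q : SkewPoly σ} (h : ∀ i, coeff p i = coeff q i) : p = q :=
  SkewPolynomial.ext h

@[simp] theorem coeff_zero (i : ℕ) : coeff (0 : SkewPoly σ) i = 0 := rfl

@[simp] theorem coeff_add (p q : SkewPoly σ) (i : ℕ) : coeff (p + q) i = coeff p i + coeff q i :=
  SkewPolynomial.coeff_add p q i

@[simp] theorem coeff_sub (p q : SkewPoly σ) (i : ℕ) : coeff (p - q) i = coeff p i - coeff q i :=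
  SkewPolynomial.coeff_sub p q i

@[simp] theorem coeff_smul (t : K) (p : SkewPoly σ) (i : ℕ) : coeff (t • p) i = t • coeff p i :=
  rfl

theorem coeff_sum {ι : Type*} (s : Finset ι) (f : ι → SkewPoly σ) (i : ℕ) :
    coeff (∑ j ∈ s, f j) i = ∑ j ∈ s, coeff (f j) i :=
  map_sum (AddMonoidHom.mk' (fun p : SkewPoly σ => coeff p i) fun p q => coeff_add p q i) f s

theorem coeff_mon (m : ℕ) (a : L) (i : ℕ) : coeff (mon σ m a) i = if m = i then a else 0 :=
  SkewPolynomial.coeff_monomial (R := Twist σ)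

theorem mon_zero_left (a : L) : mon σ 0 a = const σ a := rfl

theorem mon_one_right (m : ℕ) : mon σ m 1 = SkewPolynomial.X ^ m :=
  SkewPolynomial.monomial_one_right_eq_X_pow (R := Twist σ) m

theorem mon_one_one : mon σ 1 1 = SkewPolynomial.X := by rw [mon_one_right, pow_one]

theorem mon_mul_mon (m l : ℕ) (a b : L) :
    mon σ m a * mon σ l b = mon σ (m + l) (a * (σ ^ m) b) :=
  SkewMonoidAlgebra.single_mul_single (k := Twist σ) (G := Multiplicative ℕ)
    (a₁ := Multiplicative.ofAdd m) (a₂ := Multiplicative.ofAdd l) (b₁ := a) (b₂ := b)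

theorem const_mul_X_pow (m : ℕ) (a : L) : const σ a * SkewPolynomial.X ^ m = mon σ m a := by
  rw [← mon_one_right, ← mon_zero_left, mon_mul_mon]
  simp

theorem algebraMap_eq_const (t : K) :
    algebraMap K (SkewPoly σ) t = const σ (algebraMap K L t) := by
  rw [Algebra.algebraMap_eq_smul_one, ← pow_zero SkewPolynomial.X, ← mon_one_right, ← map_smul,
    Algebra.algebraMap_eq_smul_one, mon_zero_left]

theorem skew_induction {P : SkewPoly σ → Prop} (p : SkewPoly σ) (hmon : ∀ m a, P (mon σ m a))
    (hadd : ∀ p q, P p → P q → P (p + q)) : P p := by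
  induction p using SkewPolynomial.induction with
  | h0 => simpa using hmon 0 0
  | ha n r q _ _ hq => exact hadd _ _ (hmon n r) hq

theorem coeff_mon_mul (m : ℕ) (a : L) (q : SkewPoly σ) (k : ℕ) :
    coeff (mon σ m a * q) k = if m ≤ k then a * (σ ^ m) (coeff q (k - m)) else 0 := by
  induction q using skew_induction with
  | hmon l b =>
    rw [mon_mul_mon, coeff_mon, coeff_mon]
    split_ifs <;> first | rfl | omega | simp
  | hadd p q hp hq =>
    rw [mul_add, coeff_add, hp, hq, coeff_add]
    split_ifs
    · rw [map_add, mul_add]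
    · simp

theorem coeff_mul (p q : SkewPoly σ) (k : ℕ) :
    coeff (p * q) k = ∑ i ∈ Finset.range (k + 1), coeff p i * (σ ^ i) (coeff q (k - i)) := by
  induction p using skew_induction with
  | hmon m a =>
    simp only [coeff_mon_mul, coeff_mon, ite_mul, zero_mul, Finset.sum_ite_eq, Finset.mem_range,
      Nat.lt_succ_iff]
  | hadd p p' hp hp' =>
    rw [add_mul, coeff_add, hp, hp', ← Finset.sum_add_distrib]
    simp only [coeff_add, add_mul]

theorem coeff_mul_zero (p q : SkewPoly σ) : coeff (p * q) 0 = coeff p 0 * coeff q 0 := by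
  simp [coeff_mul]

theorem coeff_const_mul (a : L) (q : SkewPoly σ) (k : ℕ) :
    coeff (const σ a * q) k = a * coeff q k := by
  rw [← mon_zero_left, coeff_mon_mul]
  simp

theorem coeff_mul_mon (p : SkewPoly σ) (m : ℕ) (a : L) (k : ℕ) :
    coeff (p * mon σ m a) (k + m) = coeff p k * (σ ^ k) a := by
  rw [coeff_mul, Finset.sum_eq_single_of_mem k (by simp)]
  · rw [coeff_mon, if_pos (by omega)]
  · intro i hi hik
    have hi' := Finset.mem_range.mp hi
    rw [coeff_mon, if_neg (by omega), map_zero, mul_zero]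

theorem coeff_mul_const (p : SkewPoly σ) (a : L) (k : ℕ) :
    coeff (p * const σ a) k = coeff p k * (σ ^ k) a :=
  coeff_mul_mon p 0 a k

theorem coeff_mul_X (p : SkewPoly σ) (k : ℕ) :
    coeff (p * SkewPolynomial.X) (k + 1) = coeff p k := by
  rw [← mon_one_one, coeff_mul_mon, map_one, mul_one]

theorem coeff_X_mul (q : SkewPoly σ) (k : ℕ) :
    coeff (SkewPolynomial.X * q) (k + 1) = σ (coeff q k) := by
  rw [← mon_one_one, coeff_mon_mul]
  simp

theorem coeff_X_zero : coeff (SkewPolynomial.X : SkewPoly σ) 0 = 0 := by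
  rw [← mon_one_one, coeff_mon, if_neg one_ne_zero]

theorem coeff_one (i : ℕ) : coeff (1 : SkewPoly σ) i = if i = 0 then 1 else 0 := by
  rw [← pow_zero SkewPolynomial.X, ← mon_one_right, coeff_mon]
  simp only [eq_comm]

theorem exists_mem_degLT (p : SkewPoly σ) : ∃ N, p ∈ degLT σ N := by
  obtain ⟨N, hN⟩ := (SkewPolynomial.support p).bddAbove
  refine ⟨N + 1, fun i hi => ?_⟩
  by_contra h
  have := hN (Finset.mem_coe.mpr (SkewPolynomial.mem_support_iff.mpr h))
  omega

theorem degLT_mono {M N : ℕ} (h : M ≤ N) : degLT σ M ≤ degLT σ N :=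
  fun _ hp i hi => hp i (h.trans hi)

theorem eq_zero_of_mem_degLT_zero {p : SkewPoly σ} (h : p ∈ degLT σ 0) : p = 0 :=
  coeff_ext fun i => h i (Nat.zero_le i)

theorem HasDegree.mem_degLT {p : SkewPoly σ} {m : ℕ} (h : HasDegree p m) : p ∈ degLT σ (m + 1) :=
  h.2

theorem HasDegree.ne_zero {p : SkewPoly σ} {m : ℕ} (h : HasDegree p m) : p ≠ 0 := by
  rintro rfl
  exact h.1 rfl

theorem HasDegree.lt_of_mem {p : SkewPoly σ} {m N : ℕ} (h : HasDegree p m) (hN : p ∈ degLT σ N) :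
    m < N := by
  by_contra hc
  exact h.1 (hN m (by omega))

theorem exists_hasDegree {p : SkewPoly σ} (hp : p ≠ 0) : ∃ m, HasDegree p m := by
  classical
  have hex := exists_mem_degLT p
  obtain ⟨m, hm⟩ := Nat.exists_eq_succ_of_ne_zero fun h0 : Nat.find hex = 0 =>
    hp (eq_zero_of_mem_degLT_zero (h0 ▸ Nat.find_spec hex))
  have hlt : p ∈ degLT σ (m + 1) := by
    have := Nat.find_spec hex
    rwa [hm] at this
  refine ⟨m, fun h0 => Nat.find_min hex (m := m) (by omega) fun i hi => ?_, hlt⟩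
  rcases hi.eq_or_lt with rfl | hi
  · exact h0
  · exact hlt i hi

theorem coeff_mul_add {p q : SkewPoly σ} {m l : ℕ} (hp : p ∈ degLT σ (m + 1))
    (hq : q ∈ degLT σ (l + 1)) :
    coeff (p * q) (m + l) = coeff p m * (σ ^ m) (coeff q l) := by
  rw [coeff_mul, Finset.sum_eq_single_of_mem m (by simp), Nat.add_sub_cancel_left]
  intro i _ him
  rcases lt_or_gt_of_ne him with h | h
  · rw [hq _ (by omega), map_zero, mul_zero]
  · rw [hp i h, zero_mul]

theorem mul_mem_degLT {p q : SkewPoly σ} {m l : ℕ} (hp : p ∈ degLT σ (m + 1))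
    (hq : q ∈ degLT σ (l + 1)) : p * q ∈ degLT σ (m + l + 1) := by
  intro k hk
  rw [coeff_mul]
  refine Finset.sum_eq_zero fun i _ => ?_
  rcases le_or_gt i m with h | h
  · rw [hq _ (by omega), map_zero, mul_zero]
  · rw [hp i h, zero_mul]

theorem HasDegree.mul {p q : SkewPoly σ} {m l : ℕ} (hp : HasDegree p m) (hq : HasDegree q l) :
    HasDegree (p * q) (m + l) := by
  refine ⟨?_, mul_mem_degLT hp.mem_degLT hq.mem_degLT⟩
  rw [coeff_mul_add hp.mem_degLT hq.mem_degLT]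
  exact mul_ne_zero hp.1 ((_root_.map_ne_zero _).mpr hq.1)

instance : NoZeroDivisors (SkewPoly σ) where
  eq_zero_or_eq_zero_of_mul_eq_zero {p q} h := by
    by_contra! hc
    obtain ⟨m, hm⟩ := exists_hasDegree hc.1
    obtain ⟨l, hl⟩ := exists_hasDegree hc.2
    exact (hm.mul hl).ne_zero h

theorem eq_zero_of_mul_mem_degLT {f c : SkewPoly σ} {s : ℕ} (hf : HasDegree f s)
    (h : c * f ∈ degLT σ s) : c = 0 := by
  by_contra hc
  obtain ⟨m, hm⟩ := exists_hasDegree hc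
  have := (hm.mul hf).lt_of_mem h
  omega

theorem eq_zero_of_mem_span {f p : SkewPoly σ} {s : ℕ} (hf : HasDegree f s)
    (hp : p ∈ degLT σ s) (h : p ∈ Ideal.span {f}) : p = 0 := by
  obtain ⟨c, rfl⟩ := Ideal.mem_span_singleton'.mp h
  rw [eq_zero_of_mul_mem_degLT hf hp, zero_mul]

theorem isUnit_const {a : L} (ha : a ≠ 0) : IsUnit (const σ a) :=
  (IsUnit.mk0 (G₀ := Twist σ) a ha).map (SkewPolynomial.CRingHom (R := Twist σ))

theorem HasDegree.isUnit {p : SkewPoly σ} (h : HasDegree p 0) : IsUnit p := by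
  have hp : p = const σ (coeff p 0) := coeff_ext fun i => by
    rw [← mon_zero_left, coeff_mon]
    split_ifs with hi
    · rw [hi]
    · exact h.2 i (Nat.pos_of_ne_zero (Ne.symm hi))
  rw [hp]
  exact isUnit_const h.1

theorem HasDegree.one : HasDegree (1 : SkewPoly σ) 0 :=
  ⟨by simp [coeff_one], fun i hi => by simp [coeff_one, hi.ne']⟩

theorem HasDegree.unique {p : SkewPoly σ} {m l : ℕ} (hm : HasDegree p m) (hl : HasDegree p l) :
    m = l :=
  le_antisymm (Nat.lt_succ_iff.mp (hm.lt_of_mem hl.mem_degLT))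
    (Nat.lt_succ_iff.mp (hl.lt_of_mem hm.mem_degLT))

theorem HasDegree.eq_zero_of_isUnit {p : SkewPoly σ} {m : ℕ} (h : HasDegree p m)
    (hu : IsUnit p) : m = 0 := by
  obtain ⟨q, hq⟩ := hu.exists_right_inv
  obtain ⟨l, hl⟩ := exists_hasDegree (right_ne_zero_of_mul (hq ▸ HasDegree.one.ne_zero))
  have := (h.mul hl).unique (hq ▸ HasDegree.one)
  omega

/-- The skew polynomial `∑ i < N, v i x ^ i` with the list of coefficients `v`. -/
def ofVec (σ : L ≃ₐ[K] L) (N : ℕ) : (Fin N → L) →ₗ[K] SkewPoly σ :=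
  ∑ i : Fin N, mon σ i ∘ₗ LinearMap.proj i

theorem coeff_ofVec {N : ℕ} (v : Fin N → L) (i : ℕ) :
    coeff (ofVec σ N v) i = if h : i < N then v ⟨i, h⟩ else 0 := by
  simp only [ofVec, LinearMap.sum_apply, LinearMap.comp_apply, LinearMap.proj_apply, coeff_sum,
    coeff_mon]
  split_ifs with h
  · rw [Finset.sum_eq_single_of_mem ⟨i, h⟩ (Finset.mem_univ _) fun j _ hj =>
      if_neg fun hji => hj (Fin.ext hji), if_pos rfl]
  · exact Finset.sum_eq_zero fun j _ => if_neg (by omega)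

theorem ofVec_mem_degLT {N : ℕ} (v : Fin N → L) : ofVec σ N v ∈ degLT σ N := fun i hi => by
  rw [coeff_ofVec, dif_neg (by omega)]

theorem ofVec_coeff {N : ℕ} {p : SkewPoly σ} (hp : p ∈ degLT σ N) :
    ofVec σ N (fun i => coeff p i) = p := by
  refine coeff_ext fun i => ?_
  rw [coeff_ofVec]
  split_ifs with h
  · rfl
  · exact (hp i (by omega)).symm

theorem coeff_ofVec_fin {N : ℕ} (v : Fin N → L) (i : Fin N) : coeff (ofVec σ N v) i = v i := by
  rw [coeff_ofVec, dif_pos i.2]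

theorem eq_sum_mon {N : ℕ} {p : SkewPoly σ} (hp : p ∈ degLT σ N) :
    p = ∑ i ∈ Finset.range N, mon σ i (coeff p i) := by
  conv_lhs => rw [← ofVec_coeff hp]
  simp [ofVec, Finset.sum_range]

instance (s : ℕ) : Module K (degLT σ s) :=
  inferInstanceAs (Module K ({ degLT σ s with
    smul_mem' := fun t p hp i hi => by
      rw [coeff_smul, hp i hi, smul_zero] } : Submodule K (SkewPoly σ)))

/-- The coordinates of a skew polynomial of degree less than `s` are its coefficients. -/
def degLTEquiv (σ : L ≃ₐ[K] L) (s : ℕ) : degLT σ s ≃ₗ[K] (Fin s → L) where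
  toFun p i := coeff p.1 i
  map_add' p q := funext fun i => coeff_add p.1 q.1 i
  map_smul' _ _ := rfl
  invFun v := ⟨ofVec σ s v, ofVec_mem_degLT v⟩
  left_inv p := Subtype.ext (ofVec_coeff p.2)
  right_inv v := funext fun i => coeff_ofVec_fin v i

theorem exists_eq_mul_X {p : SkewPoly σ} (h : coeff p 0 = 0) :
    ∃ q, p = q * SkewPolynomial.X := by
  obtain ⟨N, hN⟩ := exists_mem_degLT p
  refine ⟨ofVec σ N fun i => coeff p (i + 1), coeff_ext fun i => ?_⟩
  cases i with
  | zero => rw [h, coeff_mul_zero, coeff_X_zero, mul_zero]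
  | succ i =>
    rw [coeff_mul_X, coeff_ofVec]
    split_ifs with hi
    · rfl
    · exact hN _ (by omega)

theorem exists_eq_X_mul {p : SkewPoly σ} (h : coeff p 0 = 0) :
    ∃ q, p = SkewPolynomial.X * q := by
  obtain ⟨N, hN⟩ := exists_mem_degLT p
  refine ⟨ofVec σ N fun i => σ.symm (coeff p (i + 1)), coeff_ext fun i => ?_⟩
  cases i with
  | zero => rw [h, coeff_mul_zero, coeff_X_zero, zero_mul]
  | succ i =>
    rw [coeff_X_mul, coeff_ofVec]
    split_ifs with hi
    · rw [AlgEquiv.apply_symm_apply]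
    · rw [hN _ (by omega), map_zero]

end SkewPolyBasic

section Lift

variable {K L : Type*} [Field K] [Field L] [Algebra K L] {σ : L ≃ₐ[K] L}
variable {B : Type*} [Ring B] [Algebra K B]

theorem map_pow_apply_mul_pow (f : L →ₐ[K] B) (t : B) (h : ∀ a, t * f a = f (σ a) * t) (m : ℕ)
    (a : L) : f ((σ ^ m) a) * t ^ m = t ^ m * f a := by
  induction m with
  | zero => simp
  | succ m ih =>
    rw [pow_succ' t, mul_assoc, ← ih, ← mul_assoc, ← mul_assoc, h, pow_succ' σ]
    rfl

/-- The universal property of `L[x;σ]`: an algebra homomorphism `f` on `L` extends to `L[x;σ]` by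
`x ↦ t` as soon as `t` and the image of `f` satisfy the commutation rule of `L[x;σ]`. -/
def skewLift (f : L →ₐ[K] B) (t : B) (h : ∀ a, t * f a = f (σ a) * t) : SkewPoly σ →ₐ[K] B :=
  SkewMonoidAlgebra.liftNCAlgHom (A := Twist σ) (G := Multiplicative ℕ)
    (show Twist σ →ₐ[K] B from f) (powersHom B t)
    (by intro x y; exact map_pow_apply_mul_pow f t h (Multiplicative.toAdd y) x)

variable {f : L →ₐ[K] B} {t : B} {h : ∀ a, t * f a = f (σ a) * t}

theorem skewLift_mon (m : ℕ) (a : L) : skewLift f t h (mon σ m a) = f a * t ^ m :=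
  SkewMonoidAlgebra.liftNC_single (k := Twist σ) (G := Multiplicative ℕ)
    (show Twist σ →+ B from f.toRingHom.toAddMonoidHom) (powersHom B t) (Multiplicative.ofAdd m) a

theorem skewLift_X : skewLift f t h SkewPolynomial.X = t := by
  rw [← mon_one_one, skewLift_mon, map_one, one_mul, pow_one]

theorem skewLift_eq_sum {N : ℕ} {p : SkewPoly σ} (hp : p ∈ degLT σ N) :
    skewLift f t h p = ∑ i ∈ Finset.range N, f (coeff p i) * t ^ i := by
  conv_lhs => rw [eq_sum_mon hp]
  simp only [map_sum, skewLift_mon]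

end Lift

/-! ### The fixed field -/

section FixedField

variable {K L : Type*} [Field K] [Field L] [Algebra K L] {σ : L ≃ₐ[K] L}

theorem isGaloisGroup_zpowers (hfix : ∀ a : L, σ a = a ↔ a ∈ Set.range (algebraMap K L)) :
    IsGaloisGroup (Subgroup.zpowers σ) K L where
  faithful := inferInstance
  commutes := inferInstance
  isInvariant := ⟨fun a h => (hfix a).mp (h ⟨σ, Subgroup.mem_zpowers σ⟩)⟩

instance [FiniteDimensional K L] : NeZero (orderOf σ) := ⟨(orderOf_pos σ).ne'⟩

theorem finiteDimensional_of_orderOf_pos (σ : L ≃ₐ[K] L) [IsGaloisGroup (Subgroup.zpowers σ) K L]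
    (h : 0 < orderOf σ) : FiniteDimensional K L :=
  have : Finite (Subgroup.zpowers σ) := (orderOf_pos_iff.mp h).finite_zpowers
  IsGaloisGroup.finiteDimensional (Subgroup.zpowers σ) K L

variable [IsGaloisGroup (Subgroup.zpowers σ) K L]

variable (σ) in
theorem finrank_eq_orderOf : Module.finrank K L = orderOf σ := by
  rw [← IsGaloisGroup.card_eq_finrank (Subgroup.zpowers σ) K L, Nat.card_zpowers]

theorem exists_algebraMap_eq_of_apply_eq {a : L} (h : σ a = a) : ∃ t, algebraMap K L t = a := by
  have hstab : Subgroup.zpowers σ ≤ MulAction.stabilizer (L ≃ₐ[K] L) a :=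
    Subgroup.zpowers_le.mpr h
  exact (IsGaloisGroup.isInvariant (G := Subgroup.zpowers σ)).isInvariant a fun g => hstab g.2

theorem exists_map_algebraMap_eq {p : L[X]} (h : p.map (σ : L →+* L) = p) :
    ∃ q : K[X], q.map (algebraMap K L) = p := by
  refine (Polynomial.lifts_iff_coeff_lifts (f := algebraMap K L) p).mpr fun i =>
    exists_algebraMap_eq_of_apply_eq (σ := σ) ?_
  conv_rhs => rw [← h, Polynomial.coeff_map]
  rfl

variable (σ) in
theorem algebraMap_norm_eq_prod [FiniteDimensional K L] (a : L) :
    algebraMap K L (Algebra.norm K a) = ∏ i : Fin (orderOf σ), (σ ^ (i : ℕ)) a := by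
  have : IsGalois K L := IsGaloisGroup.isGalois (Subgroup.zpowers σ) K L
  have hbij : Function.Bijective fun i : Fin (orderOf σ) => σ ^ (i : ℕ) := by
    rw [Fintype.bijective_iff_injective_and_card, Fintype.card_fin, ← Nat.card_eq_fintype_card,
      IsGalois.card_aut_eq_finrank, finrank_eq_orderOf σ]
    exact ⟨fun i j h => Fin.ext (pow_injOn_Iio_orderOf i.2 j.2 h), rfl⟩
  rw [Algebra.norm_eq_prod_automorphisms]
  exact (hbij.prod_comp fun g : L ≃ₐ[K] L => g a).symm

end FixedField

/-! ### The central polynomials `F(x ^ n)` and the quotients of `L[x;σ]` -/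

section Central

variable {K L : Type*} [Field K] [Field L] [Algebra K L] {σ : L ≃ₐ[K] L}

theorem evalXPow_comm (F : K[X]) (p : SkewPoly σ) : evalXPow σ F * p = p * evalXPow σ F :=
  (Subalgebra.mem_center_iff.mp (evalXPow_mem_center σ F) p).symm

theorem evalXPow_mul (F G : K[X]) : evalXPow σ (F * G) = evalXPow σ F * evalXPow σ G :=
  map_mul _ _ _

theorem evalXPow_monomial (m : ℕ) (t : K) :
    evalXPow σ (monomial m t) = mon σ (orderOf σ * m) (algebraMap K L t) := by
  rw [evalXPow, aeval_monomial, ← pow_mul, algebraMap_eq_const, const_mul_X_pow]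

section NeZero

variable [NeZero (orderOf σ)]

theorem coeff_evalXPow (F : K[X]) (i : ℕ) :
    coeff (evalXPow σ F) i =
      if orderOf σ ∣ i then algebraMap K L (F.coeff (i / orderOf σ)) else 0 := by
  induction F using Polynomial.induction_on' with
  | add p q hp hq =>
    have hadd : evalXPow σ (p + q) = evalXPow σ p + evalXPow σ q := map_add _ _ _
    rw [hadd, coeff_add, hp, hq]
    split_ifs <;> simp
  | monomial m t =>
    rw [evalXPow_monomial, coeff_mon, Polynomial.coeff_monomial]
    by_cases h : orderOf σ ∣ i
    · obtain ⟨j, rfl⟩ := h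
      rw [if_pos (dvd_mul_right _ _), Nat.mul_div_cancel_left _ (NeZero.pos _), apply_ite
        (algebraMap K L), map_zero]
      simp only [mul_eq_mul_left_iff, NeZero.ne (orderOf σ), or_false]
    · rw [if_neg h, if_neg fun hm => h ⟨m, hm.symm⟩]

theorem coeff_evalXPow_mul (F : K[X]) (i : ℕ) :
    coeff (evalXPow σ F) (orderOf σ * i) = algebraMap K L (F.coeff i) := by
  rw [coeff_evalXPow, if_pos (dvd_mul_right _ _), Nat.mul_div_cancel_left _ (NeZero.pos _)]

theorem coeff_evalXPow_zero (F : K[X]) :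
    coeff (evalXPow σ F) 0 = algebraMap K L (F.coeff 0) :=
  coeff_evalXPow_mul F 0

theorem hasDegree_evalXPow {F : K[X]} (hF : F ≠ 0) :
    HasDegree (evalXPow σ F) (orderOf σ * F.natDegree) := by
  refine ⟨?_, fun i hi => ?_⟩
  · rw [coeff_evalXPow_mul]
    simpa using hF
  · rw [coeff_evalXPow]
    split_ifs with h
    · obtain ⟨j, rfl⟩ := h
      rw [Nat.mul_div_cancel_left _ (NeZero.pos _),
        coeff_eq_zero_of_natDegree_lt (Nat.lt_of_mul_lt_mul_left hi), map_zero]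
    · rfl

end NeZero

/-- The projection `R → R_F` as a `K`-algebra homomorphism. -/
def mkₐ (σ : L ≃ₐ[K] L) (F : K[X]) : SkewPoly σ →ₐ[K] RF σ F :=
  Ideal.Quotient.mkₐ K (centralIdeal σ F)

theorem mkₐ_apply (F : K[X]) (a : SkewPoly σ) : mkₐ σ F a = mk σ F a := rfl

theorem mk_surjective (F : K[X]) : Function.Surjective (mk σ F) :=
  Ideal.Quotient.mk_surjective

theorem mk_eq_zero_iff {F : K[X]} {a : SkewPoly σ} :
    mk σ F a = 0 ↔ ∃ c, a = c * evalXPow σ F := by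
  simp only [@eq_comm _ a, ← Ideal.mem_span_singleton']
  exact Ideal.Quotient.eq_zero_iff_mem

variable {f : SkewPoly σ} {s : ℕ}

/-- Every class of `R / R f` contains exactly one skew polynomial of degree less than `deg f`. -/
def degLTEquivQuot (hf : HasDegree f s) : degLT σ s ≃ₗ[K] (SkewPoly σ ⧸ Ideal.span {f}) :=
  LinearEquiv.ofBijective
    { toFun (a : degLT σ s) :=
        (Submodule.Quotient.mk (a : SkewPoly σ) : SkewPoly σ ⧸ Ideal.span {f})
      map_add' _ _ := rfl
      map_smul' _ _ := rfl } (by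
      constructor
      · exact (injective_iff_map_eq_zero _).mpr fun a ha => Subtype.ext <|
          eq_zero_of_mem_span hf a.2 ((Submodule.Quotient.mk_eq_zero _).mp ha)
      · intro u
        obtain ⟨p, rfl⟩ := Submodule.Quotient.mk_surjective _ u
        obtain ⟨r, hr⟩ := exists_remainder hf p
        exact ⟨r, ((Submodule.Quotient.eq _).mpr hr).symm⟩)

/-- The coordinates on `R / R f` given by the coefficients of the remainder modulo `f`. -/
def quotEquiv (hf : HasDegree f s) : (SkewPoly σ ⧸ Ideal.span {f}) ≃ₗ[K] (Fin s → L) :=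
  (degLTEquivQuot hf).symm ≪≫ₗ degLTEquiv σ s

theorem finiteDimensional_quot [FiniteDimensional K L] (hf : HasDegree f s) :
    FiniteDimensional K (SkewPoly σ ⧸ Ideal.span {f}) :=
  (quotEquiv hf).symm.finiteDimensional

theorem finrank_quot [FiniteDimensional K L] [IsGaloisGroup (Subgroup.zpowers σ) K L]
    (hf : HasDegree f s) : Module.finrank K (SkewPoly σ ⧸ Ideal.span {f}) = s * orderOf σ := by
  rw [(quotEquiv hf).finrank_eq, ← finrank_eq_orderOf σ, Module.finrank_pi_fintype,
    Finset.sum_const, Finset.card_univ, Fintype.card_fin, smul_eq_mul]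

theorem nontrivial_quot (hf : HasDegree f s) (hs : 0 < s) :
    Nontrivial (SkewPoly σ ⧸ Ideal.span {f}) :=
  have : Nonempty (Fin s) := ⟨⟨0, hs⟩⟩
  (quotEquiv hf).toEquiv.nontrivial

end Central

/-! ### The reduced norm -/

section ShiftMatrix

variable {L : Type*} [Field L]

/-- The matrix of `x` in the regular representation of `L[x;σ]` over `L[y]`, where `y = x ^ n`. -/
def shiftMatrix (n : ℕ) (L : Type*) [Field L] : Matrix (Fin n) (Fin n) L[X] :=
  Matrix.of fun i l => if (i + 1 : ℕ) % n = l then X ^ ((i + 1 : ℕ) / n) else 0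

theorem shiftMatrix_pow (n m : ℕ) (i l : Fin n) :
    (shiftMatrix n L ^ m) i l =
      if (i + m : ℕ) % n = l then (X : L[X]) ^ ((i + m : ℕ) / n) else 0 := by
  have hn : 0 < n := i.pos
  induction m generalizing l with
  | zero =>
    rw [pow_zero, Matrix.one_apply, add_zero, Nat.mod_eq_of_lt i.2, Nat.div_eq_of_lt i.2, pow_zero]
    simp only [Fin.ext_iff]
  | succ m ih =>
    rw [pow_succ, Matrix.mul_apply,
      Finset.sum_eq_single_of_mem ⟨(i + m : ℕ) % n, Nat.mod_lt _ hn⟩ (Finset.mem_univ _)]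
    · have hmod : ((i + m : ℕ) % n + 1) % n = (i + (m + 1) : ℕ) % n := by
        rw [Nat.mod_add_mod, add_assoc]
      have hdiv : (i + m : ℕ) / n + ((i + m : ℕ) % n + 1) / n = (i + (m + 1) : ℕ) / n := by
        conv_rhs => rw [← add_assoc, ← Nat.div_add_mod (i + m : ℕ) n, add_assoc,
          Nat.mul_add_div hn]
      rw [ih]
      simp only [if_true, shiftMatrix, Matrix.of_apply]
      rw [hmod, mul_ite, mul_zero, ← pow_add, hdiv]
    · intro k _ hk
      rw [ih, if_neg fun h => hk (Fin.ext h.symm), zero_mul]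

theorem shiftMatrix_pow_self (n : ℕ) :
    shiftMatrix n L ^ n = algebraMap L[X] (Matrix (Fin n) (Fin n) L[X]) X := by
  ext1 i l
  rw [shiftMatrix_pow, Nat.add_mod_right, Nat.mod_eq_of_lt i.2, Nat.add_div_right _ i.pos,
    Nat.div_eq_of_lt i.2, Matrix.algebraMap_matrix_apply]
  simp [Fin.ext_iff]

theorem det_shiftMatrix_ne_zero (n : ℕ) : (shiftMatrix n L).det ≠ 0 := by
  rcases n.eq_zero_or_pos with rfl | hn
  · rw [Matrix.det_isEmpty]
    exact one_ne_zero
  · intro h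
    have hdet := congrArg Matrix.det (shiftMatrix_pow_self (L := L) n)
    rw [Matrix.det_pow, h, zero_pow hn.ne', Algebra.algebraMap_eq_smul_one, Matrix.det_smul,
      Matrix.det_one, mul_one, Fintype.card_fin] at hdet
    exact pow_ne_zero _ X_ne_zero hdet.symm

theorem mapMatrix_shiftMatrix {L' : Type*} [Field L'] (g : L →+* L') (n : ℕ) :
    (mapRingHom g).mapMatrix (shiftMatrix n L) = shiftMatrix n L' := by
  ext1 i l
  simp only [shiftMatrix, RingHom.mapMatrix_apply, Matrix.map_apply, Matrix.of_apply]
  split_ifs <;> simp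

/-- The cyclic permutation matrix, which is the value of `shiftMatrix` at `y = 1`. -/
def cyclicMatrix (n : ℕ) (L : Type*) [Field L] : Matrix (Fin n) (Fin n) L :=
  (evalRingHom (1 : L)).mapMatrix (shiftMatrix n L)

theorem cyclicMatrix_pow (n m : ℕ) (i l : Fin n) :
    (cyclicMatrix n L ^ m) i l = if (i + m : ℕ) % n = l then 1 else 0 := by
  rw [cyclicMatrix, ← map_pow, RingHom.mapMatrix_apply, Matrix.map_apply, shiftMatrix_pow]
  split_ifs <;> simp

theorem det_cyclicMatrix (n : ℕ) : (cyclicMatrix n L).det = (-1) ^ (n - 1) := by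
  have h : cyclicMatrix n L = (finRotate n).permMatrix L := by
    ext1 i l
    rcases n with _ | n
    · exact i.elim0
    · rw [← pow_one (cyclicMatrix _ L), cyclicMatrix_pow, Equiv.Perm.permMatrix, Equiv.toPEquiv,
        PEquiv.toMatrix_apply]
      simp [Fin.ext_iff, Fin.val_add]
  rw [h, Matrix.det_permutation, sign_finRotate]
  simp

end ShiftMatrix

section DetDegree

variable {R : Type*} [CommRing R] {n m : ℕ} {M : Matrix (Fin n) (Fin n) R[X]}

theorem natDegree_det_le (h : ∀ i j, (M i j).natDegree ≤ m) : M.det.natDegree ≤ n * m := by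
  rw [Matrix.det_apply]
  refine natDegree_sum_le_of_forall_le _ _ fun π _ => (natDegree_smul_le _ _).trans ?_
  refine (natDegree_prod_le _ _).trans ((Finset.sum_le_card_nsmul _ _ m fun i _ => h _ _).trans ?_)
  rw [Finset.card_univ, Fintype.card_fin, smul_eq_mul]

theorem coeff_det_of_natDegree_le (h : ∀ i j, (M i j).natDegree ≤ m) :
    M.det.coeff (n * m) = (M.map fun p => p.coeff m).det := by
  rw [Matrix.det_apply, Matrix.det_apply, finsetSum_coeff]
  refine Finset.sum_congr rfl fun π _ => ?_
  have hprod := coeff_prod_of_natDegree_le (s := Finset.univ) (fun i => M (π i) i) m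
    fun i _ => h _ _
  rw [Finset.card_univ, Fintype.card_fin] at hprod
  rw [Polynomial.coeff_smul, hprod]
  rfl

end DetDegree

section RegularRepresentation

variable {K L : Type*} [Field K] [Field L] [Algebra K L] {σ : L ≃ₐ[K] L}

/-- The diagonal matrix with entries `a, σ a, σ ^ 2 a, …`, which represents `a ∈ L` in the regular
representation of `L[x;σ]`. -/
def diagMatrix (σ : L ≃ₐ[K] L) : L →ₐ[K] Matrix (Fin (orderOf σ)) (Fin (orderOf σ)) L[X] :=
  (Matrix.diagonalAlgHom K).comp (AlgHom.pi fun i =>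
    (CAlgHom (R := K) (A := L)).comp ((σ ^ (i : ℕ) : L ≃ₐ[K] L) : L →ₐ[K] L))

theorem diagMatrix_apply (a : L) :
    diagMatrix σ a = Matrix.diagonal fun i : Fin (orderOf σ) => (C ((σ ^ (i : ℕ)) a) : L[X]) :=
  rfl

theorem shiftMatrix_mul_diagMatrix (a : L) :
    shiftMatrix (orderOf σ) L * diagMatrix σ a =
      diagMatrix σ (σ a) * shiftMatrix (orderOf σ) L := by
  ext1 i l
  rw [diagMatrix_apply, diagMatrix_apply, Matrix.mul_diagonal, Matrix.diagonal_mul]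
  simp only [shiftMatrix, Matrix.of_apply]
  split_ifs with h
  · rw [← h, pow_mod_orderOf, mul_comm, pow_succ]
    rfl
  · rw [zero_mul, mul_zero]

theorem mapMatrix_diagMatrix (a : L) :
    (mapRingHom (σ : L →+* L)).mapMatrix (diagMatrix σ a) = diagMatrix σ (σ a) := by
  rw [diagMatrix_apply, diagMatrix_apply, RingHom.mapMatrix_apply,
    Matrix.diagonal_map (map_zero _)]
  congr 1
  funext i
  have hcomm : σ ((σ ^ (i : ℕ)) a) = (σ ^ (i : ℕ)) (σ a) := by
    rw [← AlgEquiv.mul_apply, ← AlgEquiv.mul_apply, ← pow_succ, ← pow_succ']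
  rw [coe_mapRingHom, Polynomial.map_C, ← hcomm]
  rfl

/-- The regular representation of `L[x;σ]` over `L[y]`, where `y = x ^ n`. -/
def regRep (σ : L ≃ₐ[K] L) : SkewPoly σ →ₐ[K] Matrix (Fin (orderOf σ)) (Fin (orderOf σ)) L[X] :=
  skewLift (diagMatrix σ) (shiftMatrix (orderOf σ) L) shiftMatrix_mul_diagMatrix

theorem regRep_evalXPow (F : K[X]) :
    regRep σ (evalXPow σ F) = algebraMap L[X] _ (F.map (algebraMap K L)) := by
  rw [evalXPow, ← aeval_algHom_apply, map_pow, regRep, skewLift_X, shiftMatrix_pow_self,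
    aeval_algebraMap_apply, aeval_X_left_eq_map]

theorem regRep_apply {N : ℕ} {p : SkewPoly σ} (hp : p ∈ degLT σ N) (i l : Fin (orderOf σ)) :
    regRep σ p i l = ∑ j ∈ Finset.range N, C ((σ ^ (i : ℕ)) (coeff p j)) *
      if (i + j : ℕ) % orderOf σ = l then (X : L[X]) ^ ((i + j : ℕ) / orderOf σ) else 0 := by
  rw [regRep, skewLift_eq_sum hp, Matrix.sum_apply]
  refine Finset.sum_congr rfl fun j _ => ?_
  rw [diagMatrix_apply, Matrix.diagonal_mul, shiftMatrix_pow]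

theorem shiftMatrix_mul_regRep (p : SkewPoly σ) :
    shiftMatrix (orderOf σ) L * regRep σ p =
      (mapRingHom (σ : L →+* L)).mapMatrix (regRep σ p) * shiftMatrix (orderOf σ) L := by
  induction p using skew_induction with
  | hmon m a =>
    rw [regRep, skewLift_mon, map_mul, map_pow, mapMatrix_shiftMatrix, mapMatrix_diagMatrix,
      ← mul_assoc, shiftMatrix_mul_diagMatrix, mul_assoc, mul_assoc, ← pow_succ, ← pow_succ']
  | hadd p q hp hq => rw [map_add, map_add, mul_add, add_mul, hp, hq]

theorem map_det_regRep (p : SkewPoly σ) :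
    (regRep σ p).det.map (σ : L →+* L) = (regRep σ p).det := by
  have h := congrArg Matrix.det (shiftMatrix_mul_regRep p)
  rw [Matrix.det_mul, Matrix.det_mul, mul_comm, ← RingHom.map_det] at h
  exact (mul_right_cancel₀ (det_shiftMatrix_ne_zero _) h).symm

/-- The matrix `∑ diag(a_j, σ a_j, …) P ^ j z ^ j`, where `P` is the cyclic permutation matrix. It
is conjugate to the regular representation over `z ^ n = y`, and the `j`-th coefficient of `p`
occurs in it with `z ^ j` only, so the extreme coefficients of the determinant can be read off. -/
def homogRep (p : SkewPoly σ) (N : ℕ) : Matrix (Fin (orderOf σ)) (Fin (orderOf σ)) L[X] :=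
  Matrix.of fun i l => ∑ j ∈ Finset.range N, C ((σ ^ (i : ℕ)) (coeff p j)) *
    if (i + j : ℕ) % orderOf σ = l then (X : L[X]) ^ j else 0

theorem diagonal_mul_homogRep {N : ℕ} {p : SkewPoly σ} (hp : p ∈ degLT σ N) :
    Matrix.diagonal (fun i : Fin (orderOf σ) => (X : L[X]) ^ (i : ℕ)) * homogRep p N =
      (expand L (orderOf σ)).mapMatrix (regRep σ p) *
        Matrix.diagonal fun i : Fin (orderOf σ) => (X : L[X]) ^ (i : ℕ) := by
  ext1 i l
  rw [Matrix.mul_diagonal, Matrix.diagonal_mul, AlgHom.mapMatrix_apply, Matrix.map_apply,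
    regRep_apply hp, map_sum, Finset.sum_mul, homogRep, Matrix.of_apply, Finset.mul_sum]
  refine Finset.sum_congr rfl fun j _ => ?_
  rw [map_mul, expand_C]
  split_ifs with h
  · rw [map_pow, expand_X, mul_left_comm, mul_assoc, ← pow_mul, ← pow_add, ← pow_add, ← h,
      Nat.div_add_mod]
  · rw [map_zero, mul_zero, mul_zero, zero_mul]

theorem det_homogRep {N : ℕ} {p : SkewPoly σ} (hp : p ∈ degLT σ N) :
    (homogRep p N).det = expand L (orderOf σ) (regRep σ p).det := by
  have h := congrArg Matrix.det (diagonal_mul_homogRep hp)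
  rw [Matrix.det_mul, Matrix.det_mul, mul_comm, ← AlgHom.map_det, Matrix.det_diagonal] at h
  exact mul_right_cancel₀ (Finset.prod_ne_zero_iff.mpr fun i _ => pow_ne_zero _ X_ne_zero) h

theorem natDegree_homogRep_le (p : SkewPoly σ) (m : ℕ) (i l : Fin (orderOf σ)) :
    (homogRep p (m + 1) i l).natDegree ≤ m := by
  rw [homogRep, Matrix.of_apply]
  refine natDegree_sum_le_of_forall_le _ _ fun j hj => (natDegree_C_mul_le _ _).trans ?_
  split_ifs
  · rw [natDegree_X_pow]
    exact Nat.lt_succ_iff.mp (Finset.mem_range.mp hj)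
  · rw [natDegree_zero]
    exact Nat.zero_le m

theorem homogRep_map_coeff (p : SkewPoly σ) {m N : ℕ} (h : m < N) :
    ((homogRep p N).map fun q => q.coeff m) =
      Matrix.diagonal (fun i : Fin (orderOf σ) => (σ ^ (i : ℕ)) (coeff p m)) *
        cyclicMatrix (orderOf σ) L ^ m := by
  ext1 i l
  rw [Matrix.diagonal_mul, cyclicMatrix_pow, Matrix.map_apply, homogRep, Matrix.of_apply,
    finsetSum_coeff, Finset.sum_eq_single_of_mem m (Finset.mem_range.mpr h)]
  · rw [coeff_C_mul]
    split_ifs <;> simp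
  · intro j _ hj
    rw [coeff_C_mul]
    split_ifs
    · rw [coeff_X_pow, if_neg hj.symm, mul_zero]
    · rw [Polynomial.coeff_zero, mul_zero]

end RegularRepresentation

section ReducedNorm

variable {K L : Type*} [Field K] [Field L] [Algebra K L] (σ : L ≃ₐ[K] L)
  [IsGaloisGroup (Subgroup.zpowers σ) K L]

/-- The reduced norm of `L[x;σ]` over its center `K[y]`, `y = x ^ n`. -/
def redNorm (p : SkewPoly σ) : K[X] :=
  (exists_map_algebraMap_eq (map_det_regRep p)).choose

theorem map_redNorm (p : SkewPoly σ) :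
    (redNorm σ p).map (algebraMap K L) = (regRep σ p).det :=
  (exists_map_algebraMap_eq (map_det_regRep p)).choose_spec

theorem redNorm_mul (p q : SkewPoly σ) : redNorm σ (p * q) = redNorm σ p * redNorm σ q := by
  refine Polynomial.map_injective _ (algebraMap K L).injective ?_
  rw [Polynomial.map_mul, map_redNorm, map_redNorm, map_redNorm, map_mul, Matrix.det_mul]

theorem redNorm_evalXPow (F : K[X]) : redNorm σ (evalXPow σ F) = F ^ orderOf σ := by
  refine Polynomial.map_injective _ (algebraMap K L).injective ?_
  rw [map_redNorm, regRep_evalXPow, Polynomial.map_pow, Algebra.algebraMap_eq_smul_one,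
    Matrix.det_smul, Matrix.det_one, mul_one, Fintype.card_fin]

variable [FiniteDimensional K L] {σ} {p : SkewPoly σ} {m : ℕ}

theorem natDegree_redNorm_le (hp : p ∈ degLT σ (m + 1)) : (redNorm σ p).natDegree ≤ m := by
  have h := natDegree_det_le (natDegree_homogRep_le p m)
  rw [det_homogRep hp, ← map_redNorm, natDegree_expand, Polynomial.natDegree_map] at h
  exact le_of_mul_le_mul_right (h.trans_eq (mul_comm _ _)) (NeZero.pos (orderOf σ))

theorem coeff_redNorm (hp : p ∈ degLT σ (m + 1)) :
    (redNorm σ p).coeff m = (-1) ^ (m * (orderOf σ - 1)) * Algebra.norm K (coeff p m) := by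
  refine (algebraMap K L).injective ?_
  have h := coeff_det_of_natDegree_le (natDegree_homogRep_le p m)
  rw [det_homogRep hp, ← map_redNorm, mul_comm (orderOf σ), coeff_expand_mul (NeZero.pos _),
    Polynomial.coeff_map, homogRep_map_coeff p m.lt_succ_self, Matrix.det_mul, Matrix.det_diagonal,
    Matrix.det_pow, det_cyclicMatrix, ← pow_mul, mul_comm _ m] at h
  rw [h, map_mul, algebraMap_norm_eq_prod σ, mul_comm, map_pow, map_neg, map_one]

theorem coeff_zero_redNorm (p : SkewPoly σ) :
    (redNorm σ p).coeff 0 = Algebra.norm K (coeff p 0) := by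
  refine (algebraMap K L).injective ?_
  obtain ⟨N, hN⟩ := exists_mem_degLT p
  have h := congrArg constantCoeff (det_homogRep (degLT_mono N.le_succ hN))
  have hmap : constantCoeff.mapMatrix (homogRep p (N + 1)) =
      (homogRep p (N + 1)).map fun q => q.coeff 0 := rfl
  have hexpand (q : L[X]) : (expand L (orderOf σ) q).coeff 0 = q.coeff 0 := by
    simpa only [zero_mul] using coeff_expand_mul (NeZero.pos (orderOf σ)) q 0
  rw [RingHom.map_det, hmap, homogRep_map_coeff p N.succ_pos, pow_zero, mul_one,
    Matrix.det_diagonal, ← algebraMap_norm_eq_prod, ← map_redNorm, constantCoeff_apply,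
    hexpand, Polynomial.coeff_map] at h
  exact h.symm

theorem redNorm_ne_zero (hp : p ≠ 0) : redNorm σ p ≠ 0 := by
  obtain ⟨m, hm⟩ := exists_hasDegree hp
  intro h
  have hcoeff := coeff_redNorm hm.mem_degLT
  rw [h, Polynomial.coeff_zero, zero_eq_mul, Algebra.norm_eq_zero_iff] at hcoeff
  exact hcoeff.elim (pow_ne_zero _ (neg_ne_zero.mpr one_ne_zero)) hm.1

end ReducedNorm

/-! ### Ranks and determinants -/

section MatrixModules

variable {E : Type*} [Field E] {n r : ℕ}

theorem exists_linearIndependent_mulVec_eq_zero (A : Matrix (Fin n) (Fin n) E)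
    (hr : A.rank + r ≤ n) :
    ∃ k : Fin r → Fin n → E, LinearIndependent E k ∧ ∀ i, A.mulVec (k i) = 0 := by
  have hker : r ≤ Module.finrank E (LinearMap.ker A.mulVecLin) := by
    have hsum := A.mulVecLin.finrank_range_add_finrank_ker
    rw [Module.finrank_fin_fun] at hsum
    have hrank : A.rank = Module.finrank E (LinearMap.range A.mulVecLin) := rfl
    omega
  obtain ⟨k, hk⟩ := exists_linearIndependent_of_le_finrank hker
  exact ⟨fun i => k i, hk.map' (LinearMap.ker A.mulVecLin).subtype (Submodule.ker_subtype _),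
    fun i => LinearMap.mem_ker.mp (k i).2⟩

theorem exists_mulVec_eq_single (i₀ : Fin n) {k : Fin r → Fin n → E}
    (hk : LinearIndependent E k) :
    ∃ N : Fin r → Matrix (Fin n) (Fin n) E,
      ∀ j i, (N j).mulVec (k i) = if j = i then Pi.single i₀ 1 else 0 := by
  obtain ⟨g, hg⟩ := (Fintype.linearCombination E k).exists_leftInverse_of_injective
    (LinearMap.ker_eq_bot.mpr (linearIndependent_iff_injective_fintypeLinearCombination.mp hk))
  have hgk (i : Fin r) : g (k i) = Pi.single i 1 := by
    simpa [Fintype.linearCombination_apply_single] using LinearMap.congr_fun hg (Pi.single i 1)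
  refine ⟨fun j => LinearMap.toMatrix'
    (LinearMap.single E (fun _ : Fin n => E) i₀ ∘ₗ LinearMap.proj j ∘ₗ g), fun j i => ?_⟩
  rw [LinearMap.toMatrix'_mulVec, LinearMap.comp_apply, LinearMap.comp_apply, hgk]
  simp only [LinearMap.proj_apply, Pi.single_apply, LinearMap.coe_single]
  split_ifs <;> simp

/-- The matrix whose column `i₀` is `v`, and whose other columns vanish. -/
def colMatrix (i₀ : Fin n) (v : Fin n → E) : Matrix (Fin n) (Fin n) E :=
  Matrix.vecMulVec v (Pi.single i₀ 1)

theorem mul_colMatrix (i₀ : Fin n) (A : Matrix (Fin n) (Fin n) E) (v : Fin n → E) :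
    A * colMatrix i₀ v = colMatrix i₀ (A.mulVec v) :=
  Matrix.mul_vecMulVec _ _ _

theorem colMatrix_zero (i₀ : Fin n) : colMatrix i₀ (0 : Fin n → E) = 0 :=
  Matrix.zero_vecMulVec _

theorem colMatrix_single_ne_zero (i₀ : Fin n) :
    colMatrix i₀ (Pi.single i₀ 1 : Fin n → E) ≠ 0 := by
  intro h
  simpa [colMatrix, Matrix.vecMulVec_apply] using congrFun (congrFun h i₀) i₀

section RingHom

variable {Ω : Type*} [Field Ω] {m : ℕ} (T : Matrix (Fin n) (Fin n) E →+* Matrix (Fin m) (Fin m) Ω)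

theorem linearIndependent_map_colMatrix_mulVec (i₀ : Fin n) {k : Fin r → Fin n → E}
    (hk : LinearIndependent E k) {w : Fin m → Ω}
    (hw : (T (colMatrix i₀ (Pi.single i₀ 1))).mulVec w ≠ 0) :
    LinearIndependent Ω fun i => (T (colMatrix i₀ (k i))).mulVec w := by
  obtain ⟨N, hN⟩ := exists_mulVec_eq_single i₀ hk
  rw [Fintype.linearIndependent_iff]
  intro c hc j
  have hNj := congrArg (fun v => (T (N j)).mulVec v) hc
  simp only [Matrix.mulVec_sum, Matrix.mulVec_smul, Matrix.mulVec_mulVec, ← map_mul,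
    mul_colMatrix, hN, Matrix.mulVec_zero] at hNj
  rw [Finset.sum_eq_single_of_mem j (Finset.mem_univ _), if_pos rfl] at hNj
  · exact (smul_eq_zero.mp hNj).resolve_right hw
  · intro i _ hi
    rw [if_neg hi.symm, colMatrix_zero, map_zero, Matrix.zero_mulVec, smul_zero]

theorem exists_linearIndependent_map_mulVec_eq_zero [NeZero n] [NeZero m]
    (A : Matrix (Fin n) (Fin n) E) (hr : A.rank + r ≤ n) :
    ∃ u : Fin r → Fin m → Ω, LinearIndependent Ω u ∧ ∀ i, (T A).mulVec (u i) = 0 := by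
  obtain ⟨k, hk, hAk⟩ := exists_linearIndependent_mulVec_eq_zero A hr
  obtain ⟨w, hw⟩ : ∃ w, (T (colMatrix 0 (Pi.single 0 1))).mulVec w ≠ 0 := by
    by_contra! hc
    exact (map_ne_zero_iff T T.injective).mpr (colMatrix_single_ne_zero 0)
      (Matrix.ext_of_mulVec_single fun i => by rw [hc, Matrix.zero_mulVec])
  refine ⟨_, linearIndependent_map_colMatrix_mulVec T 0 hk hw, fun i => ?_⟩
  rw [Matrix.mulVec_mulVec, ← map_mul, mul_colMatrix, hAk, colMatrix_zero, map_zero,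
    Matrix.zero_mulVec]

end RingHom

theorem pow_dvd_det_of_dvd_column {R : Type*} [CommRing R] (g : R) (M : Matrix (Fin n) (Fin n) R)
    (s : Finset (Fin n)) (h : ∀ j ∈ s, ∀ i, g ∣ M i j) : g ^ s.card ∣ M.det := by
  rw [Matrix.det_apply]
  refine Finset.dvd_sum fun π _ => ?_
  rw [Units.smul_def, zsmul_eq_mul, ← Finset.prod_const]
  exact ((Finset.prod_dvd_prod_of_dvd _ _ fun j hj => h j hj _).trans
    (Finset.prod_dvd_prod_of_subset _ _ _ (Finset.subset_univ _))).mul_left _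

theorem exists_det_ne_zero_of_linearIndependent {u : Fin r → Fin n → E}
    (hu : LinearIndependent E u) :
    ∃ (U : Matrix (Fin n) (Fin n) E) (ι : Fin r → Fin n), Function.Injective ι ∧ U.det ≠ 0 ∧
      ∀ i j, U j (ι i) = u i j := by
  classical
  set b := Module.Basis.extend hu.linearIndepOn_id with hb
  have : Fintype (hu.linearIndepOn_id.extend (Set.subset_univ _)) :=
    FiniteDimensional.fintypeBasisIndex b
  have hcard : Fintype.card (hu.linearIndepOn_id.extend (Set.subset_univ _)) = n := by
    rw [← Module.finrank_eq_card_basis b, Module.finrank_fin_fun]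
  let e := Fintype.equivFinOfCardEq hcard
  refine ⟨(Pi.basisFun E (Fin n)).toMatrix (b.reindex e),
    fun i => e ⟨u i, hu.linearIndepOn_id.subset_extend _ (Set.mem_range_self i)⟩,
    fun i j h => hu.injective (Subtype.ext_iff.mp (e.injective h)),
    ((Pi.basisFun E (Fin n)).isUnit_det (b.reindex e)).ne_zero, fun i j => ?_⟩
  rw [Module.Basis.toMatrix_apply, Module.Basis.reindex_apply, Equiv.symm_apply_apply, hb,
    Module.Basis.extend_apply_self, Pi.basisFun_repr]

theorem pow_dvd_det_of_linearIndependent_ker {A : Type*} [CommRing A] [IsDomain A] {g : A}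
    (hg : Prime g) {Ω : Type*} [Field Ω] {π : A →+* Ω} (hπ : Function.Surjective π)
    (hker : ∀ a, π a = 0 ↔ g ∣ a) (M : Matrix (Fin n) (Fin n) A) {u : Fin r → Fin n → Ω}
    (hu : LinearIndependent Ω u) (hMu : ∀ i, (M.map π).mulVec (u i) = 0) : g ^ r ∣ M.det := by
  classical
  obtain ⟨U, ι, hι, hdet, hU⟩ := exists_det_ne_zero_of_linearIndependent hu
  obtain ⟨V, rfl⟩ : ∃ V : Matrix (Fin n) (Fin n) A, V.map π = U :=
    ⟨U.map (Function.surjInv hπ), Matrix.ext fun i j => Function.surjInv_eq hπ _⟩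
  have hMV : g ^ r ∣ (M * V).det := by
    have := pow_dvd_det_of_dvd_column g (M * V) (Finset.univ.image ι) (by
      intro j hj i
      obtain ⟨l, _, rfl⟩ := Finset.mem_image.mp hj
      rw [← hker, ← Matrix.map_apply (f := π), Matrix.map_mul, Matrix.mul_apply]
      simp only [hU]
      exact congrFun (hMu l) i)
    rwa [Finset.card_image_of_injective _ hι, Finset.card_univ, Fintype.card_fin] at this
  rw [Matrix.det_mul] at hMV
  refine hg.pow_dvd_of_dvd_mul_right r ?_ hMV
  rwa [← hker, RingHom.map_det]

end MatrixModules

section Squarefree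

variable {K L : Type*} [Field K] [Field L] [Algebra K L] [FiniteDimensional K L]
  [Algebra.IsSeparable K L] {F : K[X]}

open scoped TensorProduct in
theorem squarefree_map_of_irreducible (hF : Irreducible F) :
    Squarefree (F.map (algebraMap K L)) := by
  have : Fact (Irreducible F) := ⟨hF⟩
  have : Algebra.FormallyUnramified K L := .of_isSeparable K L
  have : IsReduced (AdjoinRoot F ⊗[K] L) :=
    Algebra.FormallyUnramified.isReduced_of_field (AdjoinRoot F) _
  have hmap : (F.map Algebra.TensorProduct.includeRight.toRingHom).map
      (Algebra.TensorProduct.rid K L L).toRingEquiv.toRingHom = F.map (algebraMap K L) := by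
    rw [Polynomial.map_map]
    congr 1
    ext
    simp [Algebra.algebraMap_eq_smul_one]
  let e := (Algebra.TensorProduct.comm K (AdjoinRoot F) L).toRingEquiv.trans
    ((AdjoinRoot.tensorAlgEquiv (T := L) F _ rfl).toRingEquiv.trans
    (AdjoinRoot.mapRingEquiv (Algebra.TensorProduct.rid K L L).toRingEquiv _ _ (.of_eq hmap)))
  have : IsReduced (L[X] ⧸ Ideal.span {F.map (algebraMap K L)}) :=
    isReduced_of_injective e.symm e.symm.injective
  rwa [← Ideal.isRadical_iff_quotient_reduced, ← isRadical_iff_span_singleton,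
    isRadical_iff_squarefree_of_ne_zero (Polynomial.map_ne_zero hF.ne_zero)] at this

theorem pow_dvd_of_pow_dvd_map (hF : Irreducible F) {G : L[X]} (hG : Irreducible G)
    (hGF : G ∣ F.map (algebraMap K L)) {q : K[X]} {r : ℕ} (h : G ^ r ∣ q.map (algebraMap K L)) :
    F ^ r ∣ q := by
  induction r generalizing q with
  | zero => exact pow_zero F ▸ one_dvd q
  | succ r ih =>
    have hFq : F ∣ q := by
      by_contra hc
      have hcop := ((hF.coprime_iff_not_dvd).mpr hc).map (mapRingHom (algebraMap K L))
      exact hG.not_isUnit (hcop.isUnit_of_dvd' hGF ((dvd_pow_self G r.succ_ne_zero).trans h))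
    obtain ⟨q, rfl⟩ := hFq
    obtain ⟨H, hH⟩ := id hGF
    have hGH : ¬ G ∣ H := fun hd => hG.not_isUnit <|
      squarefree_map_of_irreducible (L := L) hF G (hH ▸ mul_dvd_mul_left G hd)
    rw [Polynomial.map_mul, hH, pow_succ', mul_assoc] at h
    rw [pow_succ']
    exact mul_dvd_mul_left F (ih
      (hG.prime.pow_dvd_of_dvd_mul_left r hGH ((mul_dvd_mul_iff_left hG.ne_zero).mp h)))

end Squarefree

section RankNorm

variable {K L : Type*} [Field K] [Field L] [Algebra K L] {σ : L ≃ₐ[K] L} {F : K[X]} {G : L[X]}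

/-- The reduction modulo a divisor `G` of `F` over `L` of the regular representation, as a
representation of `R_F`. -/
def residueRep (σ : L ≃ₐ[K] L) (hGF : G ∣ F.map (algebraMap K L)) :
    RF σ F →+* Matrix (Fin (orderOf σ)) (Fin (orderOf σ)) (AdjoinRoot G) :=
  Ideal.Quotient.lift (centralIdeal σ F)
    ((AdjoinRoot.mk G).mapMatrix.comp (regRep σ : SkewPoly σ →+* _)) fun a ha => by
      obtain ⟨c, rfl⟩ := Ideal.mem_span_singleton'.mp ha
      have hF : (AdjoinRoot.mk G).mapMatrix (regRep σ (evalXPow σ F)) = 0 := by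
        rw [regRep_evalXPow, Algebra.algebraMap_eq_smul_one, RingHom.mapMatrix_apply]
        ext1 i j
        rw [Matrix.map_apply, Matrix.smul_apply, smul_eq_mul, map_mul,
          AdjoinRoot.mk_eq_zero.mpr hGF, zero_mul, Matrix.zero_apply]
      rw [map_mul]
      exact mul_eq_zero_of_right _ hF

theorem residueRep_mk (hGF : G ∣ F.map (algebraMap K L)) (a : SkewPoly σ) :
    residueRep σ hGF (mk σ F a) = (regRep σ a).map (AdjoinRoot.mk G) :=
  rfl

theorem pow_dvd_redNorm_of_rank [FiniteDimensional K L] [IsGaloisGroup (Subgroup.zpowers σ) K L]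
    (hF : Irreducible F) {E : Type*} [Field E] {m r : ℕ} [NeZero m]
    (φ : RF σ F ≃+* Matrix (Fin m) (Fin m) E) {a : SkewPoly σ}
    (hr : (φ (mk σ F a)).rank + r ≤ m) : F ^ r ∣ redNorm σ a := by
  have : IsGalois K L := IsGaloisGroup.isGalois (Subgroup.zpowers σ) K L
  have hFL : ¬ IsUnit (F.map (algebraMap K L)) := by
    rw [Polynomial.isUnit_map]
    exact hF.not_isUnit
  obtain ⟨G, hG, hGF⟩ := WfDvdMonoid.exists_irreducible_factor hFL
    (Polynomial.map_ne_zero hF.ne_zero)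
  have : Fact (Irreducible G) := ⟨hG⟩
  obtain ⟨u, hu, hu0⟩ := exists_linearIndependent_map_mulVec_eq_zero
    ((residueRep σ hGF).comp (φ.symm : _ →+* RF σ F)) (φ (mk σ F a)) hr
  refine pow_dvd_of_pow_dvd_map hF hG hGF ?_
  rw [map_redNorm]
  refine pow_dvd_det_of_linearIndependent_ker hG.prime AdjoinRoot.mk_surjective
    (fun _ => AdjoinRoot.mk_eq_zero) _ hu fun i => ?_
  rw [← residueRep_mk hGF]
  simpa only [RingHom.comp_apply, RingEquiv.coe_toRingHom, φ.symm_apply_apply] using hu0 i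

end RankNorm

/-! ### The codes `S_{n,s,k}(η,ρ,F)` -/

section CodePoly

variable {K' K L : Type*} [Field K'] [Field K] [Field L] [Algebra K L] [Algebra K' L]
  {σ : L ≃ₐ[K] L} {η : L} {ρ : L ≃ₐ[K'] L} {N : ℕ}

/-- The parametrisation, by their coefficients of index less than `N`, of the skew polynomials `a`
with `deg a ≤ N` and `a_N = η a_0 ^ ρ`, where `N > 0`. -/
def codePoly (σ : L ≃ₐ[K] L) (η : L) (ρ : L ≃ₐ[K'] L) (N : ℕ) : (Fin N → L) →+ SkewPoly σ :=
  AddMonoidHom.mk' (fun v => ofVec σ N v + mon σ N (η * ρ (coeff (ofVec σ N v) 0))) fun v w => by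
    simp only [map_add, coeff_add, mul_add]
    abel

theorem codePoly_apply (v : Fin N → L) :
    codePoly σ η ρ N v = ofVec σ N v + mon σ N (η * ρ (coeff (ofVec σ N v) 0)) :=
  rfl

theorem coeff_codePoly_lt (v : Fin N → L) (i : Fin N) : coeff (codePoly σ η ρ N v) i = v i := by
  rw [codePoly_apply, coeff_add, coeff_ofVec_fin, coeff_mon, if_neg i.2.ne', add_zero]

theorem coeff_codePoly_self (hN : 0 < N) (v : Fin N → L) :
    coeff (codePoly σ η ρ N v) N = η * ρ (coeff (codePoly σ η ρ N v) 0) := by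
  rw [coeff_codePoly_lt v ⟨0, hN⟩, codePoly_apply, coeff_add, ofVec_mem_degLT v N le_rfl, coeff_mon,
    if_pos rfl, zero_add, coeff_ofVec_fin v ⟨0, hN⟩]

theorem codePoly_mem_degLT (v : Fin N → L) : codePoly σ η ρ N v ∈ degLT σ (N + 1) := fun i hi => by
  rw [codePoly_apply, coeff_add, ofVec_mem_degLT v i (by omega), coeff_mon, if_neg (by omega),
    add_zero]

theorem codePoly_coeff (hN : 0 < N) {a : SkewPoly σ} (ha : a ∈ degLT σ (N + 1))
    (haN : coeff a N = η * ρ (coeff a 0)) : codePoly σ η ρ N (fun i => coeff a i) = a := by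
  refine coeff_ext fun i => ?_
  rcases lt_trichotomy i N with h | rfl | h
  · exact coeff_codePoly_lt _ ⟨i, h⟩
  · rw [coeff_codePoly_self hN, coeff_codePoly_lt _ ⟨0, hN⟩, haN]
  · rw [codePoly_mem_degLT _ i h, ha i h]

theorem codePoly_injective : Function.Injective (codePoly σ η ρ N) := fun v w h => by
  ext i
  rw [← coeff_codePoly_lt (σ := σ) (η := η) (ρ := ρ) v, h, coeff_codePoly_lt]

theorem codeS_eq_range {k : ℕ} (η : L) (ρ : L ≃ₐ[K'] L) (F : K[X]) (hN : 0 < k * F.natDegree) :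
    codeS σ k η ρ F = Set.range fun v => mk σ F (codePoly σ η ρ (k * F.natDegree) v) := by
  ext u
  constructor
  · rintro ⟨a, ha, haN, rfl⟩
    exact ⟨_, congrArg (mk σ F) (codePoly_coeff hN ha haN)⟩
  · rintro ⟨v, rfl⟩
    exact ⟨_, codePoly_mem_degLT v, coeff_codePoly_self hN v, rfl⟩

variable [Algebra K' K] [IsScalarTower K' K L]

theorem codePoly_smul (t : K') (v : Fin N → L) :
    codePoly σ η ρ N (t • v) = algebraMap K' K t • codePoly σ η ρ N v := by
  have hη (a : L) : η * ρ (t • a) = algebraMap K' K t • (η * ρ a) := by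
    rw [map_smul, mul_smul_comm, algebraMap_smul]
  rw [codePoly_apply, ← algebraMap_smul K t v, map_smul, coeff_smul,
    algebraMap_smul K t (coeff _ 0), hη, map_smul,
    ← smul_add, codePoly_apply]

variable {M : Type*} [AddCommGroup M] [Module K M] [Module K' M] [IsScalarTower K' K M]

/-- The parametrisation by `L ^ (k s)` of the image of `S_{n,s,k}(η,ρ,F)` under a linear map. -/
def codeLinearMap (k : ℕ) (η : L) (ρ : L ≃ₐ[K'] L) {F : K[X]} (φ : RF σ F →ₗ[K] M) :
    (Fin (k * F.natDegree) → L) →ₗ[K'] M where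
  toFun v := φ (mkₐ σ F (codePoly σ η ρ (k * F.natDegree) v))
  map_add' v w := by rw [map_add, map_add, map_add]
  map_smul' t v := by rw [codePoly_smul, map_smul, map_smul, algebraMap_smul, RingHom.id_apply]

theorem range_codeLinearMap {k : ℕ} (η : L) (ρ : L ≃ₐ[K'] L) {F : K[X]} (φ : RF σ F →ₗ[K] M)
    (hN : 0 < k * F.natDegree) :
    (LinearMap.range (codeLinearMap k η ρ φ) : Set M) = φ '' codeS σ k η ρ F := by
  rw [codeS_eq_range η ρ F hN, ← Set.range_comp]
  rfl

end CodePoly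

section NormComparison

variable {K' K L : Type*} [Field K'] [Field K] [Field L] [Algebra K L]
  {σ : L ≃ₐ[K] L} [FiniteDimensional K L] [IsGaloisGroup (Subgroup.zpowers σ) K L]
  {F : K[X]} {k : ℕ} {a : SkewPoly σ}

/- If `F ^ k` divides the reduced norm of `a`, then by degrees the quotient is a constant, which is
read off both at the leading and at the constant coefficient. -/
theorem norm_coeff_zero_of_pow_dvd_redNorm (hF : F.Monic) (ha0 : a ≠ 0)
    (ha : a ∈ degLT σ (k * F.natDegree + 1)) (hdvd : F ^ k ∣ redNorm σ a) :
    coeff a (k * F.natDegree) ≠ 0 ∧ Algebra.norm K (coeff a 0) =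
      (-1) ^ (F.natDegree * k * (orderOf σ - 1)) * F.coeff 0 ^ k *
        Algebra.norm K (coeff a (k * F.natDegree)) := by
  obtain ⟨g, hg⟩ := hdvd
  have hg0 : g ≠ 0 := right_ne_zero_of_mul (hg ▸ redNorm_ne_zero ha0)
  have hdeg := natDegree_redNorm_le ha
  rw [hg, natDegree_mul (pow_ne_zero _ hF.ne_zero) hg0, natDegree_pow] at hdeg
  obtain ⟨c, rfl⟩ : ∃ c, g = C c := ⟨_, eq_C_of_natDegree_eq_zero (by omega)⟩
  have htop : c = (-1) ^ (F.natDegree * k * (orderOf σ - 1)) *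
      Algebra.norm K (coeff a (k * F.natDegree)) := by
    rw [mul_comm F.natDegree, ← coeff_redNorm ha, hg, coeff_mul_C, ← natDegree_pow,
      coeff_natDegree, (hF.pow k).leadingCoeff, one_mul]
  have hbot : Algebra.norm K (coeff a 0) = F.coeff 0 ^ k * c := by
    rw [← coeff_zero_redNorm, hg, coeff_mul_C, coeff_zero_eq_eval_zero, eval_pow,
      ← coeff_zero_eq_eval_zero]
  constructor
  · intro h
    rw [h, Algebra.norm_zero, mul_zero] at htop
    exact hg0 (by rw [htop, C_0])
  · rw [hbot, htop]
    ring

variable [Algebra K' K] [Algebra K' L] [IsScalarTower K' K L] [FiniteDimensional K' K]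
  {η : L} {ρ : L ≃ₐ[K'] L}

theorem not_pow_dvd_redNorm (hF : F.Monic) (hc : NormCond K' σ k η F) (ha0 : a ≠ 0)
    (ha : a ∈ degLT σ (k * F.natDegree + 1))
    (haN : coeff a (k * F.natDegree) = η * ρ (coeff a 0)) : ¬ F ^ k ∣ redNorm σ a := by
  have : FiniteDimensional K' L := FiniteDimensional.trans K' K L
  intro hdvd
  obtain ⟨htop, hnorm⟩ := norm_coeff_zero_of_pow_dvd_redNorm hF ha0 ha hdvd
  have hne : Algebra.norm K' (coeff a 0) ≠ 0 := Algebra.norm_ne_zero_iff.mpr fun h0 =>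
    htop (by rw [haN, h0, map_zero, mul_zero])
  refine hc (mul_right_cancel₀ hne ?_)
  calc
    _ = Algebra.norm K' ((-1) ^ (F.natDegree * k * (orderOf σ - 1)) * F.coeff 0 ^ k : K) *
          Algebra.norm K' (η * ρ (coeff a 0)) := by
      rw [map_mul (Algebra.norm K') η, Algebra.norm_eq_of_algEquiv ρ]
      ring
    _ = Algebra.norm K' (Algebra.norm K (coeff a 0)) := by
      rw [hnorm, haN, map_mul (Algebra.norm K') _ (Algebra.norm K _), Algebra.norm_norm]
    _ = 1 * Algebra.norm K' (coeff a 0) := by rw [Algebra.norm_norm, one_mul]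

theorem eq_zero_of_mk_eq_zero (hF : F.Monic) (hk : k ≤ orderOf σ) (hc : NormCond K' σ k η F)
    (ha : a ∈ degLT σ (k * F.natDegree + 1))
    (haN : coeff a (k * F.natDegree) = η * ρ (coeff a 0)) (h : mk σ F a = 0) : a = 0 := by
  by_contra ha0
  refine not_pow_dvd_redNorm hF hc ha0 ha haN ?_
  obtain ⟨c, rfl⟩ := mk_eq_zero_iff.mp h
  rw [redNorm_mul, redNorm_evalXPow]
  exact (pow_dvd_pow F hk).mul_left _

theorem mk_codePoly_injective (hF : F.Monic) (hk : k ≤ orderOf σ) (hN : 0 < k * F.natDegree)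
    (hc : NormCond K' σ k η F) :
    Function.Injective fun v => mk σ F (codePoly σ η ρ (k * F.natDegree) v) := by
  refine (injective_iff_map_eq_zero ((mkₐ σ F : SkewPoly σ →+ RF σ F).comp
    (codePoly σ η ρ (k * F.natDegree)))).mpr fun v hv => ?_
  have h0 := eq_zero_of_mk_eq_zero hF hk hc (codePoly_mem_degLT v) (coeff_codePoly_self hN v) hv
  exact (map_eq_zero_iff _ codePoly_injective).mp h0

theorem ncard_codeS (hF : F.Monic) (hk : k ≤ orderOf σ) (hN : 0 < k * F.natDegree)
    (hc : NormCond K' σ k η F) :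
    (codeS σ k η ρ F).ncard = Nat.card K ^ (orderOf σ * F.natDegree * k) := by
  rw [codeS_eq_range η ρ F hN, ← Set.image_univ,
    Set.ncard_image_of_injective _ (mk_codePoly_injective hF hk hN hc), Set.ncard_univ,
    Nat.card_fun, Nat.card_fin, Module.natCard_eq_pow_finrank (K := K) (V := L),
    finrank_eq_orderOf σ, ← pow_mul, mul_comm k, mul_assoc]

theorem codeLinearMap_injective {M : Type*} [AddCommGroup M] [Module K M] [Module K' M]
    [IsScalarTower K' K M] (hF : F.Monic) (hk : k ≤ orderOf σ) (hN : 0 < k * F.natDegree)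
    (hc : NormCond K' σ k η F) {φ : RF σ F →ₗ[K] M} (hφ : Function.Injective φ) :
    Function.Injective (codeLinearMap k η ρ φ) :=
  hφ.comp (mk_codePoly_injective hF hk hN hc)

end NormComparison

section Rank

variable {E : Type*} [Field E] {n k : ℕ}

theorem rank_le_of_forall_lt_eq_zero {A : Matrix (Fin n) (Fin n) E}
    (h : ∀ i : Fin n, (i : ℕ) < k → A i = 0) : A.rank ≤ n - k := by
  classical
  let w : Fin n → E := fun i => if (i : ℕ) < k then 0 else 1
  have hA : Matrix.diagonal w * A = A := by
    ext i j
    rw [Matrix.diagonal_mul]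
    by_cases hi : (i : ℕ) < k
    · rw [h i hi, Pi.zero_apply, mul_zero]
    · rw [show w i = 1 from if_neg hi, one_mul]
  calc
    A.rank ≤ (Matrix.diagonal w).rank := hA ▸ Matrix.rank_mul_le_left _ _
    _ = Fintype.card {i : Fin n // w i ≠ 0} := Matrix.rank_diagonal w
    _ ≤ Fintype.card (Finset.Ico k n) :=
      Fintype.card_le_of_injective (fun i => ⟨i.1, Finset.mem_Ico.mpr
        ⟨not_lt.mp fun hi => i.2 (if_pos hi), i.1.2⟩⟩) fun i j hij =>
          Subtype.ext (Fin.ext (congrArg Subtype.val hij))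
    _ = n - k := by rw [Fintype.card_coe, Nat.card_Ico]

/- The Singleton bound: a space whose dimension exceeds the number of entries in the first `k` rows
contains a nonzero matrix in which these rows vanish. -/
theorem exists_ne_zero_rank_le {K' : Type*} [Field K'] [Algebra K' E] [FiniteDimensional K' E]
    (hk : k ≤ n) (W : Submodule K' (Matrix (Fin n) (Fin n) E))
    (hW : n * k * Module.finrank K' E < Module.finrank K' W) :
    ∃ A ∈ W, A ≠ 0 ∧ A.rank ≤ n - k := by
  let f : Matrix (Fin n) (Fin n) E →ₗ[K'] (Fin k → Fin n → E) :=
    LinearMap.funLeft K' (Fin n → E) (Fin.castLE hk)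
  have hlt : Module.finrank K' (Fin k → Fin n → E) < Module.finrank K' W := by
    simpa only [Module.finrank_pi_fintype, Finset.sum_const, Finset.card_univ, Fintype.card_fin,
      smul_eq_mul, mul_left_comm k, mul_assoc] using hW
  obtain ⟨A, hA, hA0⟩ := (Submodule.ne_bot_iff _).mp
    (LinearMap.ker_ne_bot_of_finrank_lt (f := f ∘ₗ W.subtype) hlt)
  exact ⟨A, A.2, fun h => hA0 (Subtype.ext h), rank_le_of_forall_lt_eq_zero fun i hi =>
    congrFun (LinearMap.mem_ker.mp hA) ⟨i, hi⟩⟩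

end Rank

section MRD

theorem finrank_adjoinRoot {K' K : Type*} [Field K'] [Field K] [Algebra K' K] {F : K[X]}
    (hF : F.Monic) :
    Module.finrank K' (AdjoinRoot F) = Module.finrank K' K * F.natDegree := by
  have : Module.Free K (AdjoinRoot F) := hF.free_adjoinRoot
  rw [← Module.finrank_mul_finrank K' K (AdjoinRoot F),
    (AdjoinRoot.powerBasis hF.ne_zero).finrank, AdjoinRoot.powerBasis_dim]

variable {K' K L : Type*} [Field K'] [Field K] [Field L] [Algebra K' K] [Algebra K L] [Algebra K' L]
  [IsScalarTower K' K L] [FiniteDimensional K' K] [FiniteDimensional K L] {σ : L ≃ₐ[K] L}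
  [IsGaloisGroup (Subgroup.zpowers σ) K L] {F : K[X]} {k : ℕ} {η : L} {ρ : L ≃ₐ[K'] L}

theorem finrank_range_codeLinearMap {M : Type*} [AddCommGroup M] [Module K M] [Module K' M]
    [IsScalarTower K' K M] (hF : F.Monic) (hk : k ≤ orderOf σ) (hN : 0 < k * F.natDegree)
    (hc : NormCond K' σ k η F) {φ : RF σ F →ₗ[K] M} (hφ : Function.Injective φ) :
    Module.finrank K' (LinearMap.range (codeLinearMap k η ρ φ)) =
      orderOf σ * k * Module.finrank K' (AdjoinRoot F) := by
  have : FiniteDimensional K' L := FiniteDimensional.trans K' K L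
  rw [LinearMap.finrank_range_of_inj (codeLinearMap_injective hF hk hN hc hφ),
    Module.finrank_pi_fintype, finrank_adjoinRoot hF, Finset.sum_const, Finset.card_univ,
    Fintype.card_fin, smul_eq_mul, ← Module.finrank_mul_finrank K' K L, finrank_eq_orderOf σ]
  ring

theorem lt_rank_of_mem_codeS (hF : F.Monic) (hFi : Irreducible F)
    (hc : NormCond K' σ k η F) {m : ℕ} [NeZero m]
    (φ : RF σ F ≃+* Matrix (Fin m) (Fin m) (AdjoinRoot F))
    {A : Matrix (Fin m) (Fin m) (AdjoinRoot F)}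
    (hA : A ∈ φ '' codeS σ k η ρ F) (hA0 : A ≠ 0) : m < A.rank + k := by
  have : Fact (Irreducible F) := ⟨hFi⟩
  obtain ⟨_, ⟨a, ha, haN, rfl⟩, rfl⟩ := hA
  have ha0 : a ≠ 0 := by
    rintro rfl
    exact hA0 ((congrArg φ (map_zero (mkₐ σ F))).trans (map_zero φ))
  by_contra hle
  exact not_pow_dvd_redNorm hF hc ha0 ha haN (pow_dvd_redNorm_of_rank hFi φ (not_lt.mp hle))

theorem isLinearMRD_codeS (hF : F.Monic) (hFi : Irreducible F) (hk0 : k ≠ 0) (hk : k ≤ orderOf σ)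
    (hc : NormCond K' σ k η F)
    (φ : RF σ F ≃ₐ[K] Matrix (Fin (orderOf σ)) (Fin (orderOf σ)) (AdjoinRoot F)) :
    IsLinearMRD K' (φ '' codeS σ k η ρ F) (orderOf σ - k + 1) := by
  have : Fact (Irreducible F) := ⟨hFi⟩
  have : FiniteDimensional K (AdjoinRoot F) := hF.finite_adjoinRoot
  have : FiniteDimensional K' (AdjoinRoot F) := FiniteDimensional.trans K' K (AdjoinRoot F)
  have hN : 0 < k * F.natDegree := Nat.mul_pos (Nat.pos_of_ne_zero hk0) hFi.natDegree_pos
  let W := LinearMap.range (codeLinearMap k η ρ φ.toLinearMap)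
  have hWC : (W : Set _) = φ '' codeS σ k η ρ F := range_codeLinearMap η ρ φ.toLinearMap hN
  have hW : Module.finrank K' W = orderOf σ * k * Module.finrank K' (AdjoinRoot F) :=
    finrank_range_codeLinearMap hF hk hN hc φ.injective
  have hrank (A) (hA : A ∈ W) (hA0 : A ≠ 0) : orderOf σ - k + 1 ≤ A.rank := by
    have := lt_rank_of_mem_codeS hF hFi hc φ.toRingEquiv (hWC.subset hA) hA0
    omega
  rw [← hWC]
  refine ⟨⟨W, rfl, ?_⟩, fun A hA B hB hAB => hrank _ (W.sub_mem hA hB) (sub_ne_zero.mpr hAB), ?_⟩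
  · rw [hW, show orderOf σ - (orderOf σ - k + 1) + 1 = k by omega]
  · have hlt : orderOf σ * (k - 1) * Module.finrank K' (AdjoinRoot F) < Module.finrank K' W := by
      rw [hW]
      exact Nat.mul_lt_mul_of_pos_right
        (Nat.mul_lt_mul_of_pos_left (by omega) (NeZero.pos _)) Module.finrank_pos
    obtain ⟨A, hA, hA0, hAr⟩ := exists_ne_zero_rank_le (by omega) W hlt
    refine ⟨A, hA, 0, W.zero_mem, hA0, ?_⟩
    rw [sub_zero]
    exact le_antisymm (hAr.trans (by omega)) (hrank A hA hA0)

end MRD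

/-! ### Presemifields -/

section Presemifields

theorem IsPresemifield.exists_isotopic_isSemifield {k V : Type*} [Field k] [AddCommGroup V]
    [Module k V] {mul : V → V → V} (h : IsPresemifield k mul) :
    ∃ mul' : V → V → V, IsSemifield k mul' ∧ Isotopic mul mul' := by
  have := h.nontrivial
  obtain ⟨e, he⟩ := exists_ne (0 : V)
  let R : V ≃ₗ[k] V := LinearEquiv.ofBijective
    { toFun a := mul a e
      map_add' a b := h.add_mul a b e
      map_smul' t a := h.smul_mul t a e }
    ((Function.bijective_iff_existsUnique _).mpr (h.right_div e he))
  let S : V ≃ₗ[k] V := LinearEquiv.ofBijective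
    { toFun b := mul e b
      map_add' a b := h.mul_add e a b
      map_smul' t a := h.mul_smul t e a }
    ((Function.bijective_iff_existsUnique _).mpr (h.left_div e he))
  have hR (a : V) : mul (R.symm a) e = a := R.apply_symm_apply a
  have hS (b : V) : mul e (S.symm b) = b := S.apply_symm_apply b
  have hRe : R.symm (mul e e) = e := R.symm_apply_apply e
  have hSe : S.symm (mul e e) = e := S.symm_apply_apply e
  refine ⟨fun x y => mul (R.symm x) (S.symm y), ⟨?_, mul e e, fun a => ⟨?_, ?_⟩⟩,
    AddEquiv.refl V, R.toAddEquiv, S.toAddEquiv, fun a b => ?_⟩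
  · exact
      { nontrivial := h.nontrivial
        add_mul a b c := by rw [map_add, h.add_mul]
        mul_add a b c := by rw [map_add, h.mul_add]
        smul_mul t a b := by rw [map_smul, h.smul_mul]
        mul_smul t a b := by rw [map_smul, h.mul_smul]
        left_div a ha b := (S.symm.bijective.existsUnique_iff
          (p := fun x => mul (R.symm a) x = b)).mp
            (h.left_div _ (R.symm.map_ne_zero_iff.mpr ha) b)
        right_div a ha b := (R.symm.bijective.existsUnique_iff
          (p := fun y => mul y (S.symm a) = b)).mp
            (h.right_div _ (S.symm.map_ne_zero_iff.mpr ha) b) }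
  · rw [hRe, hS]
  · rw [hSe, hR]
  · exact (congrArg₂ mul (R.symm_apply_apply a) (S.symm_apply_apply b)).symm

theorem isPresemifield_of_isUnit {k E : Type*} [Field k] [Field E] [Algebra k E]
    [FiniteDimensional k E] {n : ℕ} [NeZero n] {ψ : (Fin n → E) →ₗ[k] Matrix (Fin n) (Fin n) E}
    (hψ : ∀ u, u ≠ 0 → IsUnit (ψ u)) : IsPresemifield k fun u v => (ψ u).mulVec v where
  nontrivial := inferInstance
  add_mul a b c := by rw [map_add, Matrix.add_mulVec]
  mul_add a b c := by rw [Matrix.mulVec_add]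
  smul_mul t a b := by rw [map_smul, Matrix.smul_mulVec]
  mul_smul t a b := by rw [Matrix.mulVec_smul]
  left_div a ha := (Function.bijective_iff_existsUnique _).mp
    ⟨Matrix.mulVec_injective_of_isUnit (hψ a ha), Matrix.mulVec_surjective_iff_isUnit.mpr (hψ a ha)⟩
  right_div a ha := by
    let f : (Fin n → E) →ₗ[k] (Fin n → E) :=
      { toFun u := (ψ u).mulVec a
        map_add' u v := by rw [map_add, Matrix.add_mulVec]
        map_smul' t u := by rw [map_smul, Matrix.smul_mulVec, RingHom.id_apply] }
    have hf : Function.Injective f := (injective_iff_map_eq_zero f).mpr fun u hu => by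
      by_contra hu0
      exact ha (Matrix.mulVec_injective_of_isUnit (hψ u hu0) (hu.trans (Matrix.mulVec_zero _).symm))
    exact (Function.bijective_iff_existsUnique _).mp ⟨hf, LinearMap.injective_iff_surjective.mp hf⟩

theorem isUnit_of_le_rank {E : Type*} [Field E] {n : ℕ} {A : Matrix (Fin n) (Fin n) E}
    (h : n ≤ A.rank) : IsUnit A := by
  have hle := A.rank_le_card_width
  rw [Matrix.rank_eq_finrank_span_cols] at h hle
  rw [← Matrix.linearIndependent_cols_iff_isUnit, linearIndependent_iff_card_eq_finrank_span]
  exact le_antisymm (by rwa [Fintype.card_fin]) hle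

theorem IsLinearMRD.definesSemifields {k E : Type*} [Field k] [Field E] [Algebra k E]
    [FiniteDimensional k E] {n : ℕ} [NeZero n] {C : Set (Matrix (Fin n) (Fin n) E)}
    (h : IsLinearMRD k C n) : DefinesSemifields k C := by
  obtain ⟨⟨W, rfl, hW⟩, hdist, -⟩ := h
  constructor
  · have heq : Module.finrank k (Fin n → E) = Module.finrank k W := by
      rw [hW, Module.finrank_pi_fintype, Finset.sum_const, Finset.card_univ, Fintype.card_fin,
        smul_eq_mul, Nat.sub_self, zero_add, mul_one]
    let e := LinearEquiv.ofFinrankEq _ _ heq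
    refine ⟨W.subtype ∘ₗ e.toLinearMap, Subtype.val_injective.comp e.injective, ?_⟩
    rw [LinearMap.coe_comp, LinearEquiv.coe_coe, e.surjective.range_comp]
    exact Subtype.range_coe
  · intro ψ hψ hrange
    have hpre : IsPresemifield k fun u v => (ψ u).mulVec v := isPresemifield_of_isUnit fun u hu =>
      isUnit_of_le_rank <| by
        simpa only [sub_zero] using hdist (ψ u) (hrange.subset (Set.mem_range_self u)) 0
          W.zero_mem ((map_ne_zero_iff ψ hψ).mpr hu)
    exact ⟨hpre, hpre.exists_isotopic_isSemifield⟩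

theorem definesSemifields_codeS {K' K L : Type*} [Field K'] [Field K] [Field L] [Algebra K' K]
    [Algebra K L] [Algebra K' L] [IsScalarTower K' K L] [FiniteDimensional K' K]
    [FiniteDimensional K L] {σ : L ≃ₐ[K] L} [IsGaloisGroup (Subgroup.zpowers σ) K L] {F : K[X]}
    (hF : F.Monic) (hFi : Irreducible F) {η : L} {ρ : L ≃ₐ[K'] L} (hc : NormCond K' σ 1 η F)
    (φ : RF σ F ≃ₐ[K] Matrix (Fin (orderOf σ)) (Fin (orderOf σ)) (AdjoinRoot F)) :
    DefinesSemifields K' (φ '' codeS σ 1 η ρ F) := by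
  have : Fact (Irreducible F) := ⟨hFi⟩
  have : FiniteDimensional K (AdjoinRoot F) := hF.finite_adjoinRoot
  have : FiniteDimensional K' (AdjoinRoot F) := FiniteDimensional.trans K' K (AdjoinRoot F)
  have hn : 1 ≤ orderOf σ := NeZero.one_le
  have hMRD := isLinearMRD_codeS (ρ := ρ) hF hFi one_ne_zero hn hc φ
  rw [Nat.sub_add_cancel hn] at hMRD
  exact hMRD.definesSemifields

end Presemifields

/-! ### `R_F` is a central simple algebra over `E_F` -/

section CentralSimple

variable {K L : Type*} [Field K] [Field L] [Algebra K L] {σ : L ≃ₐ[K] L}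

/-- `f` is a monic element of least degree `m` of the left ideal `J`. -/
structure IsMinimalMonic (J : Ideal (SkewPoly σ)) (f : SkewPoly σ) (m : ℕ) : Prop where
  mem : f ∈ J
  hasDegree : HasDegree f m
  coeff_eq_one : coeff f m = 1
  eq_zero_of_mem : ∀ p ∈ J, p ∈ degLT σ m → p = 0

theorem exists_isMinimalMonic {J : Ideal (SkewPoly σ)} (hJ : J ≠ ⊥) :
    ∃ f m, IsMinimalMonic J f m := by
  classical
  obtain ⟨p, hpJ, hp0⟩ := (Submodule.ne_bot_iff _).mp hJ
  have hex : ∃ m, ∃ p ∈ J, HasDegree p m := (exists_hasDegree hp0).imp fun m hm => ⟨p, hpJ, hm⟩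
  obtain ⟨f, hfJ, hf⟩ := Nat.find_spec hex
  refine ⟨const σ (coeff f (Nat.find hex))⁻¹ * f, Nat.find hex, J.mul_mem_left _ hfJ,
    ⟨?_, fun i hi => ?_⟩, ?_, fun p hp hpm => ?_⟩
  · rw [coeff_const_mul, inv_mul_cancel₀ hf.1]
    exact one_ne_zero
  · rw [coeff_const_mul, hf.2 i hi, mul_zero]
  · rw [coeff_const_mul, inv_mul_cancel₀ hf.1]
  · by_contra h0
    obtain ⟨l, hl⟩ := exists_hasDegree h0
    exact Nat.find_min hex (hl.lt_of_mem hpm) ⟨p, hp, hl⟩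

namespace IsMinimalMonic

variable {J : Ideal (SkewPoly σ)} {f : SkewPoly σ} {m : ℕ}

theorem eq_span (h : IsMinimalMonic J f m) : J = Ideal.span {f} := by
  have hle : Ideal.span {f} ≤ J := (Ideal.span_singleton_le_iff_mem J).mpr h.mem
  refine le_antisymm (fun p hp => ?_) hle
  obtain ⟨r, hr⟩ := exists_remainder h.hasDegree p
  have hrJ : (r : SkewPoly σ) ∈ J := by simpa using J.sub_mem hp (hle hr)
  rwa [h.eq_zero_of_mem _ hrJ r.2, sub_zero] at hr

variable [J.IsTwoSided]

theorem mul_const_eq (h : IsMinimalMonic J f m) (a : L) :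
    f * const σ a = const σ ((σ ^ m) a) * f := by
  refine sub_eq_zero.mp (h.eq_zero_of_mem _
    (J.sub_mem (J.mul_mem_right _ h.mem) (J.mul_mem_left _ h.mem)) fun j hj => ?_)
  rw [coeff_sub, coeff_mul_const, coeff_const_mul]
  rcases hj.eq_or_lt with rfl | hj
  · ring
  · rw [h.hasDegree.2 j hj]
    ring

theorem const_mul_eq (h : IsMinimalMonic J f m) (hf : coeff f 0 ≠ 0) (a : L) :
    const σ a * f = f * const σ a := by
  have h0 := congrArg (coeff · 0) (h.mul_const_eq a)
  simp only [coeff_mul_const, coeff_const_mul, pow_zero, AlgEquiv.one_apply] at h0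
  rw [mul_comm] at h0
  rw [h.mul_const_eq, ← mul_right_cancel₀ hf h0]

theorem X_mul_eq (h : IsMinimalMonic J f m) (hf : coeff f 0 ≠ 0) :
    SkewPolynomial.X * f = f * SkewPolynomial.X := by
  set d := SkewPolynomial.X * f - f * SkewPolynomial.X with hd
  have hdJ : d ∈ J := J.sub_mem (J.mul_mem_left _ h.mem) (J.mul_mem_right _ h.mem)
  have hdf : d = const σ (coeff d m) * f := by
    refine sub_eq_zero.mp (h.eq_zero_of_mem _ (J.sub_mem hdJ (J.mul_mem_left _ h.mem))
      fun j hj => ?_)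
    rw [coeff_sub, coeff_const_mul]
    rcases hj.eq_or_lt with rfl | hj
    · rw [h.coeff_eq_one, mul_one, sub_self]
    · obtain ⟨l, rfl⟩ := Nat.exists_eq_succ_of_ne_zero (Nat.ne_zero_of_lt hj)
      rw [h.hasDegree.2 _ hj, mul_zero, sub_zero, hd, coeff_sub, coeff_X_mul, coeff_mul_X]
      rcases (Nat.lt_succ_iff.mp hj).eq_or_lt with rfl | hl
      · rw [h.coeff_eq_one, map_one, sub_self]
      · rw [h.hasDegree.2 l hl, map_zero, sub_self]
  have hd0 : coeff d 0 = 0 := by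
    simp only [hd, coeff_sub, coeff_mul_zero, coeff_X_zero, zero_mul, mul_zero, sub_self]
  rw [hdf, coeff_const_mul] at hd0
  rw [(mul_eq_zero.mp hd0).resolve_right hf, ← mon_zero_left, map_zero, zero_mul] at hdf
  exact sub_eq_zero.mp hdf

end IsMinimalMonic

section Centre

variable [IsGaloisGroup (Subgroup.zpowers σ) K L]

theorem exists_evalXPow_eq_mon {i : ℕ} {a : L} (ha : ∀ b, b * a = a * (σ ^ i) b) (hσ : σ a = a) :
    ∃ g : K[X], evalXPow σ g = mon σ i a := by
  rcases eq_or_ne a 0 with rfl | h0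
  · exact ⟨0, by rw [map_zero]; exact map_zero _⟩
  · obtain ⟨j, rfl⟩ : orderOf σ ∣ i := orderOf_dvd_of_pow_eq_one <| AlgEquiv.ext fun b =>
      mul_left_cancel₀ h0 ((ha b).symm.trans (mul_comm b a))
    obtain ⟨t, ht⟩ := exists_algebraMap_eq_of_apply_eq hσ
    exact ⟨monomial j t, by rw [evalXPow_monomial, ht]⟩

theorem exists_evalXPow_eq_of_commute {p : SkewPoly σ} (hc : ∀ a, const σ a * p = p * const σ a)
    (hX : SkewPolynomial.X * p = p * SkewPolynomial.X) : ∃ g : K[X], evalXPow σ g = p := by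
  have hmon (i : ℕ) : ∃ g : K[X], evalXPow σ g = mon σ i (coeff p i) := by
    refine exists_evalXPow_eq_mon (fun b => ?_) ?_
    · rw [← coeff_const_mul, hc, coeff_mul_const]
    · rw [← coeff_X_mul, hX, coeff_mul_X]
  choose g hg using hmon
  obtain ⟨N, hN⟩ := exists_mem_degLT p
  refine ⟨∑ i ∈ Finset.range N, g i, ?_⟩
  rw [eq_sum_mon hN, evalXPow, map_sum]
  exact Finset.sum_congr rfl fun i _ => hg i

end Centre

theorem coeff_zero_ne_zero_of_irreducible {F : K[X]} (hFm : F.Monic) (hF : Irreducible F)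
    (hX : F ≠ X) : F.coeff 0 ≠ 0 := fun h0 =>
  hX (eq_of_monic_of_associated hFm monic_X
    (irreducible_X.associated_of_dvd hF (X_dvd_iff.mpr h0)).symm)

theorem exists_evalXPow_eq_X_mul_add [NeZero (orderOf σ)] (F : K[X]) :
    ∃ w, evalXPow σ F = SkewPolynomial.X * w + const σ (algebraMap K L (F.coeff 0)) := by
  obtain ⟨w, hw⟩ := exists_eq_X_mul (p := evalXPow σ F - const σ (algebraMap K L (F.coeff 0)))
    (by rw [coeff_sub, coeff_evalXPow_zero, ← mon_zero_left, coeff_mon, if_pos rfl, sub_self])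
  exact ⟨w, sub_eq_iff_eq_add.mp hw⟩

theorem mem_of_mul_X_mem [NeZero (orderOf σ)] {J : Ideal (SkewPoly σ)} [J.IsTwoSided] {F : K[X]}
    (hF0 : F.coeff 0 ≠ 0) (hFJ : evalXPow σ F ∈ J) {g : SkewPoly σ}
    (hg : g * SkewPolynomial.X ∈ J) : g ∈ J := by
  obtain ⟨w, hw⟩ := exists_evalXPow_eq_X_mul_add (σ := σ) F
  have hsum : g * SkewPolynomial.X * w + g * const σ (algebraMap K L (F.coeff 0)) ∈ J := by
    rw [mul_assoc, ← mul_add, ← hw]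
    exact J.mul_mem_left _ hFJ
  have hconst := (J.add_mem_iff_right (J.mul_mem_right _ hg)).mp hsum
  obtain ⟨u, hu⟩ := isUnit_const (σ := σ) ((map_ne_zero (algebraMap K L)).mpr hF0)
  rw [← hu] at hconst
  simpa using J.mul_mem_right (↑u⁻¹ : SkewPoly σ) hconst

theorem IsMinimalMonic.coeff_zero_ne_zero [NeZero (orderOf σ)] {J : Ideal (SkewPoly σ)}
    [J.IsTwoSided] {f : SkewPoly σ} {m : ℕ} (h : IsMinimalMonic J f m) {F : K[X]}
    (hF0 : F.coeff 0 ≠ 0) (hFJ : evalXPow σ F ∈ J) : coeff f 0 ≠ 0 := by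
  intro h0
  obtain ⟨g, rfl⟩ := exists_eq_mul_X h0
  refine h.hasDegree.ne_zero ?_
  rw [h.eq_zero_of_mem g (mem_of_mul_X_mem hF0 hFJ h.mem) fun i hi => ?_, zero_mul]
  rw [← coeff_mul_X, h.hasDegree.2 (i + 1) (by omega)]

theorem nontrivial_RF (σ : L ≃ₐ[K] L) [NeZero (orderOf σ)] {F : K[X]} (hF : Irreducible F) :
    Nontrivial (RF σ F) :=
  nontrivial_quot (hasDegree_evalXPow hF.ne_zero) (Nat.mul_pos (NeZero.pos _) hF.natDegree_pos)

section Simple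

variable [FiniteDimensional K L] [IsGaloisGroup (Subgroup.zpowers σ) K L] {F : K[X]}

theorem eq_centralIdeal_or_eq_top (hFm : F.Monic) (hF : Irreducible F) (hX : F ≠ X)
    {J : Ideal (SkewPoly σ)} [J.IsTwoSided] (hFJ : evalXPow σ F ∈ J) :
    J = centralIdeal σ F ∨ J = ⊤ := by
  have hJ : J ≠ ⊥ := fun h =>
    (hasDegree_evalXPow hFm.ne_zero).ne_zero ((Submodule.mem_bot _).mp (h ▸ hFJ))
  obtain ⟨f, m, h⟩ := exists_isMinimalMonic hJ
  have hf0 := h.coeff_zero_ne_zero (coeff_zero_ne_zero_of_irreducible hFm hF hX) hFJ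
  obtain ⟨g, rfl⟩ := exists_evalXPow_eq_of_commute (h.const_mul_eq hf0) (h.X_mul_eq hf0)
  by_cases hdvd : F ∣ g
  · left
    refine le_antisymm ?_ ((Ideal.span_singleton_le_iff_mem J).mpr hFJ)
    obtain ⟨q, rfl⟩ := hdvd
    rw [h.eq_span, Ideal.span_singleton_le_iff_mem, mul_comm, evalXPow_mul]
    exact Ideal.mem_span_singleton'.mpr ⟨_, rfl⟩
  · right
    obtain ⟨a, b, hab⟩ := hF.coprime_iff_not_dvd.mpr hdvd
    have hone : evalXPow σ a * evalXPow σ F + evalXPow σ b * evalXPow σ g = 1 := by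
      rw [← evalXPow_mul, ← evalXPow_mul, evalXPow, evalXPow, ← map_add, hab, map_one]
    rw [Ideal.eq_top_iff_one, ← hone]
    exact J.add_mem (J.mul_mem_left _ hFJ) (J.mul_mem_left _ h.mem)

variable (σ) in
theorem isSimpleRing_RF (hFm : F.Monic) (hF : Irreducible F) (hX : F ≠ X) :
    IsSimpleRing (RF σ F) := by
  refine isSimpleRing_iff_isTwoSided_imp.mpr ⟨nontrivial_RF σ hF, fun I _ => ?_⟩
  have hker : Ideal.comap (mkₐ σ F) ⊥ = centralIdeal σ F :=
    Ideal.ext fun p => Ideal.Quotient.eq_zero_iff_mem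
  have hmem : evalXPow σ F ∈ I.comap (mkₐ σ F) :=
    Ideal.comap_mono bot_le (hker.symm ▸ Ideal.mem_span_singleton_self _)
  have hinj := Ideal.comap_injective_of_surjective (mkₐ σ F) (mk_surjective F)
  exact (eq_centralIdeal_or_eq_top hFm hF hX hmem).imp
    (fun h => hinj (h.trans hker.symm)) Ideal.comap_eq_top_iff.mp

end Simple

/-- The embedding of `E_F` in `R_F` that maps the class of `y` to the class of `x ^ n`; its image
is the centre of `R_F` when `F ≠ y` is irreducible. -/
def centerEmbedding (σ : L ≃ₐ[K] L) (F : K[X]) : AdjoinRoot F →ₐ[K] RF σ F :=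
  Ideal.Quotient.liftₐ (Ideal.span {F})
    ((mkₐ σ F).comp (aeval ((SkewPolynomial.X : SkewPoly σ) ^ orderOf σ))) (by
      intro g hg
      obtain ⟨h, rfl⟩ := Ideal.mem_span_singleton'.mp hg
      exact mk_eq_zero_iff.mpr ⟨evalXPow σ h, evalXPow_mul h F⟩)

theorem centerEmbedding_mk (F g : K[X]) :
    centerEmbedding σ F (AdjoinRoot.mk F g) = mk σ F (evalXPow σ g) :=
  rfl

theorem centerEmbedding_injective [NeZero (orderOf σ)] {F : K[X]} (hF : Irreducible F) :
    Function.Injective (centerEmbedding σ F) := by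
  have : Fact (Irreducible F) := ⟨hF⟩
  have := nontrivial_RF σ hF
  exact (centerEmbedding σ F).toRingHom.injective

theorem centerEmbedding_commute (F : K[X]) (e : AdjoinRoot F) (u : RF σ F) :
    centerEmbedding σ F e * u = u * centerEmbedding σ F e := by
  obtain ⟨g, rfl⟩ := AdjoinRoot.mk_surjective e
  obtain ⟨p, rfl⟩ := mk_surjective F u
  rw [centerEmbedding_mk, ← mkₐ_apply, ← mkₐ_apply, ← map_mul, ← map_mul, evalXPow_comm]

theorem const_mul_eq_of_mk_mem_center [NeZero (orderOf σ)] {F : K[X]} (hF : F ≠ 0)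
    {p : SkewPoly σ} (hp : p ∈ degLT σ (orderOf σ * F.natDegree))
    (hc : mk σ F p ∈ Subalgebra.center K (RF σ F)) (a : L) :
    const σ a * p = p * const σ a := by
  refine sub_eq_zero.mp (eq_zero_of_mem_span (hasDegree_evalXPow hF) (fun j hj => ?_) ?_)
  · rw [coeff_sub, coeff_const_mul, coeff_mul_const, hp j hj, mul_zero, zero_mul, sub_zero]
  · exact Ideal.Quotient.eq.mp (Subalgebra.mem_center_iff.mp hc (mk σ F (const σ a)))

theorem X_mul_eq_of_mk_mem_center [NeZero (orderOf σ)] {F : K[X]} (hF0 : F.coeff 0 ≠ 0)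
    {p : SkewPoly σ} (hp : p ∈ degLT σ (orderOf σ * F.natDegree))
    (hc : mk σ F p ∈ Subalgebra.center K (RF σ F)) :
    SkewPolynomial.X * p = p * SkewPolynomial.X := by
  have hF : F ≠ 0 := fun h => hF0 (by rw [h, Polynomial.coeff_zero])
  obtain ⟨c, hcF⟩ := Ideal.mem_span_singleton'.mp
    (Ideal.Quotient.eq.mp (Subalgebra.mem_center_iff.mp hc (mk σ F SkewPolynomial.X)))
  have hc0 : coeff c 0 = 0 := by
    have h0 := congrArg (coeff · 0) hcF
    simp only [coeff_sub, coeff_mul_zero, coeff_X_zero, zero_mul, mul_zero, sub_self,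
      coeff_evalXPow_zero] at h0
    exact (mul_eq_zero.mp h0).resolve_right ((_root_.map_ne_zero _).mpr hF0)
  -- `c * F(x ^ n)` has degree at most `n * s`, so `c` is constant.
  have hdeg : c * evalXPow σ F ∈ degLT σ (orderOf σ * F.natDegree + 1) := fun j hj => by
    obtain ⟨l, rfl⟩ := Nat.exists_eq_succ_of_ne_zero (Nat.ne_zero_of_lt hj)
    rw [hcF, coeff_sub, coeff_X_mul, coeff_mul_X, hp l (Nat.lt_succ_iff.mp hj), map_zero, sub_self]
  have hcz : c = 0 := by
    by_contra hne
    obtain ⟨m, hm⟩ := exists_hasDegree hne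
    have hlt := (hm.mul (hasDegree_evalXPow hF)).lt_of_mem hdeg
    obtain rfl : m = 0 := by omega
    exact hm.1 hc0
  rw [hcz, zero_mul] at hcF
  exact sub_eq_zero.mp hcF.symm

theorem exists_algEquiv_matrix_of_isCentral (E A : Type*) [Field E] [Ring A] [Algebra E A]
    [Algebra.IsCentral E A] [IsSimpleRing A] [Finite A] :
    ∃ m, Nonempty (A ≃ₐ[E] Matrix (Fin m) (Fin m) E) := by
  have : Module.Finite E A := Module.Finite.of_finite
  have : IsArtinianRing A := IsArtinianRing.of_finite E A
  obtain ⟨m, _, D, _, _, _, ⟨e⟩⟩ := IsSimpleRing.exists_algEquiv_matrix_divisionRing_finite E A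
  have : Finite E := Finite.of_injective _ (algebraMap E A).injective
  have : Finite D := Module.finite_of_finite E
  have hcomm (a b : D) : a * b = b * a := (littleWedderburn D).mul_comm a b
  have hsurj : Function.Surjective (algebraMap E D) := fun d => by
    have hd : e.symm (Matrix.scalar (Fin m) d) ∈ Subalgebra.center E A :=
      Subalgebra.mem_center_iff.mpr fun b => e.injective <| by
        rw [map_mul, map_mul, e.apply_symm_apply]
        exact (Matrix.scalar_commute d (hcomm d) (e b)).eq.symm
    obtain ⟨t, ht⟩ := Algebra.mem_bot.mp (Algebra.IsCentral.out hd)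
    have := congrFun (congrFun (congrArg e ht) 0) 0
    exact ⟨t, by simpa [Matrix.algebraMap_matrix_apply] using this⟩
  exact ⟨m, ⟨e.trans (AlgEquiv.ofBijective (Algebra.ofId E D)
    ⟨(algebraMap E D).injective, hsurj⟩).symm.mapMatrix⟩⟩

section Centre

variable [FiniteDimensional K L] [IsGaloisGroup (Subgroup.zpowers σ) K L] {F : K[X]}

theorem exists_centerEmbedding_eq (hF0 : F.coeff 0 ≠ 0) {u : RF σ F}
    (hu : u ∈ Subalgebra.center K (RF σ F)) : ∃ e, centerEmbedding σ F e = u := by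
  have hF : F ≠ 0 := fun h => hF0 (by rw [h, Polynomial.coeff_zero])
  obtain ⟨p, rfl⟩ := (degLTEquivQuot (hasDegree_evalXPow (σ := σ) hF)).surjective u
  obtain ⟨g, hg⟩ := exists_evalXPow_eq_of_commute (const_mul_eq_of_mk_mem_center hF p.2 hu)
    (X_mul_eq_of_mk_mem_center hF0 p.2 hu)
  exact ⟨AdjoinRoot.mk F g, by rw [centerEmbedding_mk, hg]; rfl⟩

theorem nonempty_algEquiv_of_orderOf_eq_one (h1 : orderOf σ = 1) (hFm : F.Monic)
    (hF : Irreducible F) :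
    Nonempty (RF σ F ≃ₐ[K] Matrix (Fin (orderOf σ)) (Fin (orderOf σ)) (AdjoinRoot F)) := by
  have hdeg := hasDegree_evalXPow (σ := σ) hFm.ne_zero
  have := finiteDimensional_quot hdeg
  have : FiniteDimensional K (AdjoinRoot F) := hFm.finite_adjoinRoot
  have hfr : Module.finrank K (AdjoinRoot F) = Module.finrank K (RF σ F) := by
    rw [finrank_quot hdeg, finrank_adjoinRoot hFm, Module.finrank_self, h1]
    ring
  have hinj := centerEmbedding_injective (σ := σ) hF
  have hsurj := (LinearMap.injective_iff_surjective_of_finrank_eq_finrank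
    (f := (centerEmbedding σ F).toLinearMap) hfr).mp hinj
  rw [h1]
  have hscalar : Function.Bijective (Matrix.scalarAlgHom (Fin 1) K (α := AdjoinRoot F)) := by
    refine ⟨fun _ _ => Matrix.scalar_inj.mp, fun M => ⟨M 0 0, ?_⟩⟩
    ext i j
    simp [Subsingleton.elim i 0, Subsingleton.elim j 0]
  exact ⟨(AlgEquiv.ofBijective _ ⟨hinj, hsurj⟩).symm.trans (AlgEquiv.ofBijective _ hscalar)⟩

theorem nonempty_algEquiv_of_finite [Finite L] (hFm : F.Monic) (hF : Irreducible F)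
    (hX : F ≠ X) :
    Nonempty (RF σ F ≃ₐ[K] Matrix (Fin (orderOf σ)) (Fin (orderOf σ)) (AdjoinRoot F)) := by
  have hdeg := hasDegree_evalXPow (σ := σ) hFm.ne_zero
  have : Fact (Irreducible F) := ⟨hF⟩
  have := isSimpleRing_RF σ hFm hF hX
  have : Finite (RF σ F) := Finite.of_equiv _ (quotEquiv hdeg).symm.toEquiv
  let := (centerEmbedding σ F).toRingHom.toAlgebra' (centerEmbedding_commute F)
  have : IsScalarTower K (AdjoinRoot F) (RF σ F) :=
    .of_algebraMap_eq fun t => ((centerEmbedding σ F).commutes t).symm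
  have : Algebra.IsCentral (AdjoinRoot F) (RF σ F) := ⟨fun u hu =>
    exists_centerEmbedding_eq (coeff_zero_ne_zero_of_irreducible hFm hF hX) hu⟩
  obtain ⟨m, ⟨e⟩⟩ := exists_algEquiv_matrix_of_isCentral (AdjoinRoot F) (RF σ F)
  have hfr := (e.restrictScalars K).toLinearEquiv.finrank_eq
  have : FiniteDimensional K (AdjoinRoot F) := hFm.finite_adjoinRoot
  rw [finrank_quot hdeg, Module.finrank_matrix, finrank_adjoinRoot hFm, Module.finrank_self,
    Fintype.card_fin, one_mul] at hfr
  obtain rfl : m = orderOf σ := by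
    refine Nat.mul_self_inj.mp (Nat.eq_of_mul_eq_mul_right hF.natDegree_pos ?_)
    rw [← hfr]
    ring
  exact ⟨e.restrictScalars K⟩

end Centre

end CentralSimple

/-! ### Cyclic semifields -/

section SimpleModule

theorem exists_irreducible_aeval_smul_eq_zero {k R : Type*} (M : Type*) [Field k] [Ring R]
    [Algebra k R] [AddCommGroup M] [Module k M] [Module R M] [IsScalarTower k R M]
    [IsSimpleModule R M] [FiniteDimensional k M] {c : R} (hc : c ∈ Subalgebra.center k R) :
    ∃ F : k[X], F.Monic ∧ Irreducible F ∧ ∀ u : M, aeval c F • u = 0 := by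
  classical
  have : SMulCommClass (Subalgebra.center k R) R M := ⟨fun a r u => by
    rw [Subalgebra.smul_def, Subalgebra.smul_def, ← mul_smul, ← mul_smul,
      Subalgebra.mem_center_iff.mp a.2 r]⟩
  have : Module.Finite k (Module.End R M) :=
    .of_injective (LinearMap.restrictScalarsₗ k R M M k) (LinearMap.restrictScalars_injective k)
  let act : Subalgebra.center k R →ₐ[k] Module.End R M := Algebra.lsmul k R M
  have hact : ∀ (F : k[X]) (u : M), aeval (act ⟨c, hc⟩) F u = aeval c F • u := fun F u => by
    rw [aeval_algHom_apply]
    exact congrArg (· • u) (aeval_algHom_apply (Subalgebra.center k R).val ⟨c, hc⟩ F).symm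
  have hint : IsIntegral k (act ⟨c, hc⟩) := Algebra.IsIntegral.isIntegral _
  -- By Schur's lemma `End_R(M)` is a division ring, so minimal polynomials are irreducible.
  refine ⟨minpoly k (act ⟨c, hc⟩), minpoly.monic hint, minpoly.irreducible hint, fun u => ?_⟩
  rw [← hact, minpoly.aeval, LinearMap.zero_apply]

theorem exists_equivariant_injective {K E U : Type*} [Field K] [Field E] [Algebra K E]
    [AddCommGroup U] [Module K U] [Nontrivial U] {n : ℕ} [NeZero n]
    (T : Matrix (Fin n) (Fin n) E →ₐ[K] Module.End K U) :
    ∃ Θ : (Fin n → E) →ₗ[K] U, Function.Injective Θ ∧ ∀ M v, Θ (M.mulVec v) = T M (Θ v) := by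
  obtain ⟨w, hw⟩ : ∃ w, T (colMatrix 0 (Pi.single 0 1)) w ≠ 0 := by
    by_contra! hc
    exact colMatrix_single_ne_zero (E := E) (0 : Fin n)
      ((map_eq_zero_iff T T.toRingHom.injective).mp (LinearMap.ext hc))
  let Θ : (Fin n → E) →ₗ[K] U :=
    { toFun v := T (colMatrix 0 v) w
      map_add' v v' := by
        rw [colMatrix, Matrix.add_vecMulVec, map_add, LinearMap.add_apply, colMatrix, colMatrix]
      map_smul' t v := by
        rw [colMatrix, Matrix.smul_vecMulVec, map_smul, LinearMap.smul_apply, colMatrix,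
          RingHom.id_apply] }
  have hΘ : ∀ M v, Θ (M.mulVec v) = T M (Θ v) := fun M v => by
    change T (colMatrix 0 (M.mulVec v)) w = (T M * T (colMatrix 0 v)) w
    rw [← map_mul, mul_colMatrix]
  refine ⟨Θ, LinearMap.ker_eq_bot.mp (LinearMap.ker_eq_bot'.mpr fun v hv => ?_), hΘ⟩
  by_contra hv0
  have hli : LinearIndependent E fun _ : Fin 1 => v := by
    simpa only [linearIndependent_unique_iff] using hv0
  obtain ⟨N, hN⟩ := exists_mulVec_eq_single (0 : Fin n) hli
  refine hw ?_
  have hN0 : Θ ((N 0).mulVec v) = 0 := by rw [hΘ, hv, map_zero]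
  rwa [hN, if_pos rfl] at hN0

end SimpleModule

section Petit

variable {K' K L : Type*} [Field K'] [Field K] [Field L] [Algebra K L] [Algebra K' L]
  {σ : L ≃ₐ[K] L} {F : K[X]} {f : SkewPoly σ} {s : ℕ}

/-- The action of `R_F` on `R / R f`, for `F(x ^ n) ∈ R f`. -/
def quotRep (hFf : evalXPow σ F ∈ Ideal.span {f}) :
    RF σ F →ₐ[K] Module.End K (SkewPoly σ ⧸ Ideal.span {f}) :=
  Ideal.Quotient.liftₐ (centralIdeal σ F) (Algebra.lsmul K K _) (by
    intro a ha
    obtain ⟨c, rfl⟩ := Ideal.mem_span_singleton'.mp ha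
    refine LinearMap.ext fun u => ?_
    obtain ⟨p, rfl⟩ := Submodule.mkQ_surjective _ u
    change Submodule.Quotient.mk (c * evalXPow σ F * p) = 0
    rw [Submodule.Quotient.mk_eq_zero, mul_assoc, evalXPow_comm, ← mul_assoc]
    exact Ideal.mul_mem_left _ _ hFf)

theorem quotRep_mk (hFf : evalXPow σ F ∈ Ideal.span {f}) (a : SkewPoly σ)
    (u : SkewPoly σ ⧸ Ideal.span {f}) : quotRep hFf (mk σ F a) u = a • u :=
  rfl

theorem exists_injective_mulVec_eq_smul [NeZero (orderOf σ)] (hF : Irreducible F)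
    (hf : HasDegree f s) (hs : 0 < s) (hFf : evalXPow σ F ∈ Ideal.span {f})
    (φ : RF σ F ≃ₐ[K] Matrix (Fin (orderOf σ)) (Fin (orderOf σ)) (AdjoinRoot F)) :
    ∃ Θ : (Fin (orderOf σ) → AdjoinRoot F) →ₗ[K] SkewPoly σ ⧸ Ideal.span {f},
      Function.Injective Θ ∧ ∀ a v, Θ ((φ (mk σ F a)).mulVec v) = a • Θ v := by
  have : Fact (Irreducible F) := ⟨hF⟩
  have := nontrivial_quot hf hs
  obtain ⟨Θ, hΘ, hΘM⟩ := exists_equivariant_injective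
    ((quotRep hFf).comp φ.symm.toAlgHom)
  refine ⟨Θ, hΘ, fun a v => ?_⟩
  rw [hΘM, ← quotRep_mk hFf, AlgHom.comp_apply, AlgEquiv.toAlgHom_apply,
    φ.symm_apply_apply]

theorem finrank_pi_adjoinRoot (hFm : F.Monic) (hF : Irreducible F) :
    Module.finrank K (Fin (orderOf σ) → AdjoinRoot F) = F.natDegree * orderOf σ := by
  have : Fact (Irreducible F) := ⟨hF⟩
  have : FiniteDimensional K (AdjoinRoot F) := hFm.finite_adjoinRoot
  rw [Module.finrank_pi_fintype, Fin.sum_const, finrank_adjoinRoot hFm, Module.finrank_self,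
    one_mul, smul_eq_mul, mul_comm]

theorem degLTEquivQuot_petitMul (hf : HasDegree f s) (a b : degLT σ s) :
    degLTEquivQuot hf (petitMul hf a b) = (a : SkewPoly σ) • degLTEquivQuot hf b :=
  ((Submodule.Quotient.eq _).mpr (petitMul_spec hf a b)).symm

theorem petitMul_eq_of_mem (hf : HasDegree f s) {a b : degLT σ s}
    (h : (a * b : SkewPoly σ) ∈ degLT σ s) : petitMul hf a b = ⟨a * b, h⟩ := by
  refine Subtype.ext (sub_eq_zero.mp ?_).symm
  exact eq_zero_of_mem_span hf ((degLT σ s).sub_mem h (petitMul hf a b).2) (petitMul_spec hf a b)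

theorem petitMul_eq_petitMul_of_degree_one {f' : SkewPoly σ} (hf : HasDegree f 1)
    (hf' : HasDegree f' 1) : petitMul hf = petitMul hf' := by
  funext a b
  have hab : (a * b : SkewPoly σ) ∈ degLT σ 1 := mul_mem_degLT a.2 b.2
  rw [petitMul_eq_of_mem hf hab, petitMul_eq_of_mem hf' hab]

theorem codeS_one_zero (ρ : L ≃ₐ[K'] L) (F : K[X]) :
    codeS σ 1 0 ρ F = mk σ F '' degLT σ F.natDegree := by
  ext u
  simp only [codeS, one_mul, zero_mul, Set.mem_ofPred_eq, Set.mem_image, SetLike.mem_coe]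
  constructor
  · rintro ⟨a, hgt, heq, rfl⟩
    exact ⟨a, fun i hi => hi.eq_or_lt.elim (fun h => h ▸ heq) (hgt i), rfl⟩
  · rintro ⟨a, ha, rfl⟩
    exact ⟨a, fun i hi => ha i hi.le, ha _ le_rfl, rfl⟩

theorem isSpreadSetOf_petitMul [FiniteDimensional K L] [IsGaloisGroup (Subgroup.zpowers σ) K L]
    (ρ : L ≃ₐ[K'] L) (hFm : F.Monic) (hF : Irreducible F) (hs : F.natDegree = s)
    (hf : HasDegree f s) (hFf : evalXPow σ F ∈ Ideal.span {f})
    (φ : RF σ F ≃ₐ[K] Matrix (Fin (orderOf σ)) (Fin (orderOf σ)) (AdjoinRoot F)) :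
    IsSpreadSetOf (φ '' codeS σ 1 0 ρ F) (petitMul hf) := by
  subst hs
  have : FiniteDimensional K (AdjoinRoot F) := hFm.finite_adjoinRoot
  have := finiteDimensional_quot hf
  obtain ⟨Θ, hΘ, hΘM⟩ := exists_injective_mulVec_eq_smul hF hf hF.natDegree_pos hFf φ
  have hdim : Module.finrank K (Fin (orderOf σ) → AdjoinRoot F) =
      Module.finrank K (SkewPoly σ ⧸ Ideal.span {f}) := by
    rw [finrank_pi_adjoinRoot hFm hF, finrank_quot hf]
  let Θ' := LinearEquiv.ofInjectiveOfFinrankEq Θ hΘ hdim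
  let B : degLT σ F.natDegree ≃ₗ[K] (Fin (orderOf σ) → AdjoinRoot F) :=
    (degLTEquivQuot hf).trans Θ'.symm
  have hB : ∀ b, Θ (B b) = degLTEquivQuot hf b := fun b => Θ'.apply_symm_apply _
  have hmul : ∀ a b : degLT σ F.natDegree,
      (φ (mk σ F a)).mulVec (B b) = B (petitMul hf a b) := fun a b => hΘ <| by
    rw [hΘM, hB, hB, degLTEquivQuot_petitMul]
  rw [codeS_one_zero]
  refine ⟨B.toAddEquiv, fun a => ⟨_, ⟨_, ⟨a, a.2, rfl⟩, rfl⟩, hmul a⟩, ?_⟩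
  rintro _ ⟨_, ⟨a, ha, rfl⟩, rfl⟩
  exact ⟨⟨a, ha⟩, hmul ⟨a, ha⟩⟩

theorem HasDegree.pos_of_irreducible (hf : HasDegree f s) (hirr : Irreducible f) : 0 < s := by
  rcases s.eq_zero_or_pos with rfl | hs
  · exact absurd hf.isUnit hirr.not_isUnit
  · exact hs

theorem isSimpleModule_quot (hirr : Irreducible f) :
    IsSimpleModule (SkewPoly σ) (SkewPoly σ ⧸ Ideal.span {f}) := by
  obtain ⟨s, hf⟩ := exists_hasDegree hirr.ne_zero
  rw [isSimpleModule_iff_isCoatom]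
  refine ⟨(Submodule.Quotient.nontrivial_iff).mp (nontrivial_quot hf (hf.pos_of_irreducible hirr)),
    fun J hJ => ?_⟩
  obtain ⟨g, m, hg⟩ := exists_isMinimalMonic (bot_lt_iff_ne_bot.mp (bot_le.trans_lt hJ))
  rw [hg.eq_span] at hJ ⊢
  obtain ⟨c, hc⟩ := Ideal.mem_span_singleton'.mp (hJ.le (Ideal.mem_span_singleton_self f))
  refine (hirr.isUnit_or_isUnit hc.symm).elim (fun hu => absurd hJ.le ?_)
    fun hu => Ideal.eq_top_of_isUnit_mem _ (Ideal.mem_span_singleton_self g) hu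
  obtain ⟨u, rfl⟩ := hu
  refine fun _ => hJ.not_ge ((Ideal.span_singleton_le_iff_mem _).mpr ?_)
  exact Ideal.mem_span_singleton'.mpr ⟨(u⁻¹ : (SkewPoly σ)ˣ), by rw [← hc, u.inv_mul_cancel_left]⟩

theorem exists_irreducible_evalXPow_mem [FiniteDimensional K L] (hirr : Irreducible f) :
    ∃ F : K[X], F.Monic ∧ Irreducible F ∧ evalXPow σ F ∈ Ideal.span {f} := by
  obtain ⟨s, hf⟩ := exists_hasDegree hirr.ne_zero
  have := finiteDimensional_quot hf
  have := isSimpleModule_quot hirr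
  obtain ⟨F, hFm, hF, hzero⟩ := exists_irreducible_aeval_smul_eq_zero
    (SkewPoly σ ⧸ Ideal.span {f}) (X_pow_mem_center σ)
  refine ⟨F, hFm, hF, (Submodule.Quotient.mk_eq_zero _).mp ?_⟩
  rw [← hzero (Submodule.Quotient.mk 1), ← Submodule.Quotient.mk_smul, smul_eq_mul, mul_one,
    evalXPow]

theorem natDegree_eq_of_algEquiv [FiniteDimensional K L]
    [IsGaloisGroup (Subgroup.zpowers σ) K L] (hFm : F.Monic) (hF : Irreducible F)
    (hf : HasDegree f s) (hirr : Irreducible f) (hFf : evalXPow σ F ∈ Ideal.span {f})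
    (φ : RF σ F ≃ₐ[K] Matrix (Fin (orderOf σ)) (Fin (orderOf σ)) (AdjoinRoot F)) :
    F.natDegree = s := by
  have : Fact (Irreducible F) := ⟨hF⟩
  have := isSimpleModule_quot hirr
  obtain ⟨Θ, hΘ, hΘM⟩ :=
    exists_injective_mulVec_eq_smul hF hf (hf.pos_of_irreducible hirr) hFf φ
  let W : Submodule (SkewPoly σ) (SkewPoly σ ⧸ Ideal.span {f}) :=
    { LinearMap.range Θ with
      smul_mem' := by
        rintro a _ ⟨v, rfl⟩
        exact ⟨_, hΘM a v⟩ }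
  have hW : W ≠ ⊥ := by
    obtain ⟨v, hv⟩ := exists_ne (0 : Fin (orderOf σ) → AdjoinRoot F)
    exact W.ne_bot_iff.mpr ⟨Θ v, ⟨v, rfl⟩, (map_ne_zero_iff Θ hΘ).mpr hv⟩
  have hsurj : Function.Surjective Θ := fun u =>
    ((eq_bot_or_eq_top W).resolve_left hW ▸ Submodule.mem_top : u ∈ W)
  have hdim := (LinearEquiv.ofBijective Θ ⟨hΘ, hsurj⟩).finrank_eq
  rw [finrank_pi_adjoinRoot hFm hF, finrank_quot hf] at hdim
  exact Nat.eq_of_mul_eq_mul_right (NeZero.pos _) hdim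

theorem mem_span_of_X_mul_mem (hf0 : coeff f 0 ≠ 0) {p : SkewPoly σ}
    (hp : SkewPolynomial.X * p ∈ Ideal.span {f}) : p ∈ Ideal.span {f} := by
  obtain ⟨c, hc⟩ := Ideal.mem_span_singleton'.mp hp
  have hc0 : coeff c 0 * coeff f 0 = 0 := by
    rw [← coeff_mul_zero, hc, coeff_mul_zero, SkewMRD.coeff_X_zero, zero_mul]
  obtain ⟨c', rfl⟩ := exists_eq_X_mul ((mul_eq_zero.mp hc0).resolve_right hf0)
  rw [mul_assoc] at hc
  exact Ideal.mem_span_singleton'.mpr ⟨c', mul_left_cancel₀ SkewPolynomial.X_ne_zero hc⟩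

theorem evalXPow_X_notMem_span (hs : 0 < s) (hf : HasDegree f s) (hf0 : coeff f 0 ≠ 0) :
    evalXPow σ X ∉ Ideal.span {f} := by
  rw [evalXPow, aeval_X]
  generalize orderOf σ = e
  induction e with
  | zero =>
    rw [pow_zero, ← Ideal.eq_top_iff_one]
    exact Submodule.Quotient.nontrivial_iff.mp (nontrivial_quot hf hs)
  | succ e ih =>
    rw [pow_succ']
    exact fun h => ih (mem_span_of_X_mul_mem hf0 h)

theorem hasDegree_X : HasDegree (SkewPolynomial.X : SkewPoly σ) 1 := by
  rw [← mon_one_one]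
  exact ⟨by simp [coeff_mon], fun i hi => by rw [coeff_mon, if_neg hi.ne]⟩

theorem hasDegree_X_sub_one : HasDegree (SkewPolynomial.X - 1 : SkewPoly σ) 1 := by
  rw [← mon_one_one]
  refine ⟨by simp [coeff_mon, SkewMRD.coeff_one], fun i hi => ?_⟩
  rw [SkewMRD.coeff_sub, coeff_mon, SkewMRD.coeff_one, if_neg hi.ne, if_neg (by omega), sub_zero]

theorem evalXPow_X_sub_one_mem_span :
    evalXPow σ (X - 1 : K[X]) ∈ Ideal.span {(SkewPolynomial.X - 1 : SkewPoly σ)} := by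
  rw [evalXPow, map_sub, aeval_X, map_one, ← geom_sum_mul]
  exact Ideal.mul_mem_left _ _ (Ideal.mem_span_singleton_self _)

theorem HasDegree.eq_one_of_irreducible (hf : HasDegree f s) (hirr : Irreducible f)
    (hf0 : coeff f 0 = 0) : s = 1 := by
  obtain ⟨g, rfl⟩ := exists_eq_mul_X hf0
  have hg := (hirr.isUnit_or_isUnit rfl).resolve_right fun hu =>
    one_ne_zero (hasDegree_X.eq_zero_of_isUnit hu)
  obtain ⟨m, hm⟩ := exists_hasDegree hg.ne_zero
  obtain rfl := hm.eq_zero_of_isUnit hg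
  exact hf.unique (by simpa using hm.mul hasDegree_X)

theorem exists_isSpreadSetOf_petitMul [Finite L] [FiniteDimensional K L]
    [IsGaloisGroup (Subgroup.zpowers σ) K L] (ρ : L ≃ₐ[K'] L) (hf : HasDegree f s)
    (hirr : Irreducible f) :
    ∃ F : K[X], F.Monic ∧ Irreducible F ∧ F.natDegree = s ∧ F ≠ X ∧
      ∀ φ : RF σ F ≃ₐ[K] Matrix (Fin (orderOf σ)) (Fin (orderOf σ)) (AdjoinRoot F),
        IsSpreadSetOf (φ '' codeS σ 1 0 ρ F) (petitMul hf) := by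
  by_cases hf0 : coeff f 0 = 0
  -- Here `f` is a scalar multiple of `x` and divides only `y`; as products of constants need no
  -- reduction, `x - 1` gives the same multiplication.
  · obtain rfl := hf.eq_one_of_irreducible hirr hf0
    have hdeg : (X - 1 : K[X]).natDegree = 1 := natDegree_X_sub_C 1
    refine ⟨X - 1, monic_X_sub_C 1, irreducible_X_sub_C 1, hdeg, by simp, fun φ => ?_⟩
    rw [petitMul_eq_petitMul_of_degree_one hf hasDegree_X_sub_one]
    exact isSpreadSetOf_petitMul ρ (monic_X_sub_C 1) (irreducible_X_sub_C 1) hdeg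
      hasDegree_X_sub_one evalXPow_X_sub_one_mem_span φ
  · obtain ⟨F, hFm, hF, hFf⟩ := exists_irreducible_evalXPow_mem hirr
    have hFX : F ≠ X := by
      rintro rfl
      exact evalXPow_X_notMem_span (hf.pos_of_irreducible hirr) hf hf0 hFf
    obtain ⟨φ₀⟩ := nonempty_algEquiv_of_finite (σ := σ) hFm hF hFX
    have hdeg := natDegree_eq_of_algEquiv hFm hF hf hirr hFf φ₀
    exact ⟨F, hFm, hF, hdeg, hFX, isSpreadSetOf_petitMul ρ hFm hF hdeg hf hFf⟩

end Petit

/-! ### Twisted Gabidulin codes and generalised twisted fields -/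

section Gabidulin

variable {K L : Type*} [Field K] [Field L] [Algebra K L] {σ : L ≃ₐ[K] L}

theorem toLinearMap_pow_apply (i : ℕ) (b : L) :
    ((σ : L →ₗ[K] L) ^ i : Module.End K L) b = (σ ^ i) b := by
  rw [Module.End.pow_apply, LinearEquiv.coe_coe, AlgEquiv.coe_toLinearEquiv]
  exact congrFun (AlgEquiv.coe_pow σ i).symm b

/-- The action of `L[x;σ]` on `L` in which `x` acts by `σ`, so that a skew polynomial acts as the
corresponding linearized polynomial. -/
def linearizedAction (σ : L ≃ₐ[K] L) : SkewPoly σ →ₐ[K] Module.End K L :=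
  skewLift (Algebra.lmul K L) (σ : L →ₗ[K] L) fun a => LinearMap.ext fun b => map_mul σ a b

theorem linearizedAction_apply {N : ℕ} {p : SkewPoly σ} (hp : p ∈ degLT σ N) (b : L) :
    linearizedAction σ p b = ∑ i ∈ Finset.range N, coeff p i * (σ ^ i) b := by
  rw [linearizedAction, skewLift_eq_sum hp, LinearMap.sum_apply]
  refine Finset.sum_congr rfl fun i _ => ?_
  rw [Module.End.mul_apply, toLinearMap_pow_apply]
  rfl

theorem linearizedAction_evalXPow : linearizedAction σ (evalXPow σ (X - 1 : K[X])) = 0 := by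
  rw [evalXPow, map_sub, aeval_X, map_one, map_sub, map_pow, map_one, linearizedAction, skewLift_X,
    sub_eq_zero]
  refine LinearMap.ext fun b => ?_
  rw [toLinearMap_pow_apply, pow_orderOf_eq_one, AlgEquiv.one_apply, Module.End.one_apply]

/-- The map `R_{y-1} → End_K(L)` induced by the action on `L`. -/
def linearizedMap (σ : L ≃ₐ[K] L) : RF σ (X - 1 : K[X]) →ₐ[K] Module.End K L :=
  Ideal.Quotient.liftₐ (centralIdeal σ (X - 1)) (linearizedAction σ) (by
    intro a ha
    obtain ⟨c, rfl⟩ := Ideal.mem_span_singleton'.mp ha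
    rw [map_mul, linearizedAction_evalXPow, mul_zero])

theorem natDegree_X_sub_one : (X - 1 : K[X]).natDegree = 1 :=
  natDegree_X_sub_C 1

section Isomorphism

variable [FiniteDimensional K L] [IsGaloisGroup (Subgroup.zpowers σ) K L]

theorem linearizedMap_bijective : Function.Bijective (linearizedMap σ) := by
  have hmonic : (X - 1 : K[X]).Monic := monic_X_sub_C 1
  have hdeg := hasDegree_evalXPow (σ := σ) hmonic.ne_zero
  have := finiteDimensional_quot hdeg
  have := isSimpleRing_RF σ hmonic (irreducible_X_sub_C 1) (by simp)
  have hinj : Function.Injective (linearizedMap σ).toLinearMap :=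
    (linearizedMap σ).toRingHom.injective
  have hdim : Module.finrank K (RF σ (X - 1 : K[X])) = Module.finrank K (Module.End K L) := by
    rw [finrank_quot hdeg, natDegree_X_sub_one, mul_one, Module.finrank_linearMap,
      finrank_eq_orderOf σ]
  exact ⟨hinj, (LinearMap.injective_iff_surjective_of_finrank_eq_finrank hdim).mp hinj⟩

/-- The isomorphism `R_{y-1} ≅ End_K(L)` induced by the action on `L`. -/
def linearizedEquiv (σ : L ≃ₐ[K] L) [IsGaloisGroup (Subgroup.zpowers σ) K L] :
    RF σ (X - 1 : K[X]) ≃ₐ[K] Module.End K L :=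
  AlgEquiv.ofBijective (linearizedMap σ) linearizedMap_bijective

theorem linearizedEquiv_mk (a : SkewPoly σ) :
    linearizedEquiv σ (mk σ (X - 1) a) = linearizedAction σ a :=
  rfl

theorem isLinearizedCorrespondence_linearizedEquiv :
    IsLinearizedCorrespondence σ (linearizedEquiv σ) := by
  intro a b
  obtain ⟨N, hN⟩ := exists_mem_degLT a
  rw [linearizedEquiv_mk, linearizedAction_apply hN]
  refine (Finset.sum_subset (fun i hi => ?_) fun i _ hi => ?_).symm
  · by_contra h
    exact SkewPolynomial.mem_support_iff.mp hi (hN i (by simpa using h))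
  · rw [show coeff a i = 0 from SkewPolynomial.notMem_support_iff.mp hi, zero_mul]

theorem image_codeS_eq_twistedGabidulin {K' : Type*} [Field K'] [Algebra K' L] (ρ : L ≃ₐ[K'] L)
    {k : ℕ} (hk : 0 < k) (η : L) :
    linearizedEquiv σ '' codeS σ k η ρ (X - 1) = twistedGabidulin σ k η ρ := by
  have happly : ∀ a ∈ degLT σ (k + 1), coeff a k = η * ρ (coeff a 0) → ∀ b,
      linearizedAction σ a b =
        (∑ i ∈ Finset.range k, coeff a i * (σ ^ i) b) + η * ρ (coeff a 0) * (σ ^ k) b :=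
    fun a ha hak b => by rw [linearizedAction_apply ha, Finset.sum_range_succ, hak]
  ext g
  constructor
  · rintro ⟨_, ⟨a, hgt, heq, rfl⟩, rfl⟩
    rw [natDegree_X_sub_one, mul_one] at hgt heq
    exact ⟨coeff a, happly a hgt heq⟩
  · rintro ⟨c, hc⟩
    let a := codePoly σ η ρ k fun i => c i
    have ha : ∀ i < k, coeff a i = c i := fun i hi => coeff_codePoly_lt _ ⟨i, hi⟩
    have hmem : a ∈ degLT σ (k + 1) := codePoly_mem_degLT _
    have heq : coeff a k = η * ρ (coeff a 0) := coeff_codePoly_self hk _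
    refine ⟨mk σ _ a, ⟨a, ?_, ?_, rfl⟩, LinearMap.ext fun b => ?_⟩
    · rwa [natDegree_X_sub_one, mul_one]
    · rwa [natDegree_X_sub_one, mul_one]
    · rw [linearizedEquiv_mk, happly a hmem heq, hc, ha 0 hk]
      congr 1
      exact Finset.sum_congr rfl fun i hi => by rw [ha i (Finset.mem_range.mp hi)]

end Isomorphism

theorem twistedGabidulin_one {K' : Type*} [Field K'] [Algebra K' L] (ρ : L ≃ₐ[K'] L) (η : L) :
    twistedGabidulin σ 1 η ρ = spreadSetEnd K (twistedMul ρ σ (-η)) := by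
  ext g
  simp only [twistedGabidulin, spreadSetEnd, twistedMul, Finset.sum_range_one, pow_zero, pow_one,
    AlgEquiv.one_apply, neg_mul, sub_neg_eq_add, Set.mem_ofPred_eq]
  exact ⟨fun ⟨c, hc⟩ => ⟨c 0, hc⟩, fun ⟨a, ha⟩ => ⟨fun _ => a, ha⟩⟩

end Gabidulin

section NormCond

variable {K' K L : Type*} [Field K'] [Field K] [Field L]
  [Algebra K' K] [Algebra K L] [Algebra K' L] {σ : L ≃ₐ[K] L}

theorem normCond_zero [FiniteDimensional K' L] (k : ℕ) (F : K[X]) : NormCond K' σ k 0 F := by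
  rw [NormCond, Algebra.norm_zero, zero_mul]
  exact zero_ne_one

theorem norm_neg_one_pow (m : ℕ) :
    Algebra.norm K' ((-1) ^ m : K) = (-1) ^ (m * Module.finrank K' K) := by
  rw [show ((-1) ^ m : K) = algebraMap K' K ((-1) ^ m) by simp, Algebra.norm_algebraMap, ← pow_mul]

theorem mul_neg_one_pow_eq_one_iff {a : K} (m : ℕ) : a * (-1) ^ m = 1 ↔ a = (-1) ^ m := by
  rw [mul_eq_one_iff_eq_inv₀ (pow_ne_zero _ (neg_ne_zero.mpr one_ne_zero)), ← inv_pow, inv_neg_one]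

theorem normCond_X_sub_one_iff [NeZero (orderOf σ)] (k : ℕ) (η : L) :
    NormCond K' σ k η (X - 1 : K[X]) ↔
      Algebra.norm K' η ≠ (-1) ^ (orderOf σ * k * Module.finrank K' K) := by
  have hexp : 1 * k * (orderOf σ - 1) + k = orderOf σ * k := by
    obtain ⟨m, hm⟩ := Nat.exists_eq_succ_of_ne_zero (NeZero.ne (orderOf σ))
    rw [hm, Nat.succ_sub_one, Nat.succ_eq_add_one]
    ring
  have hcoeff : (X - 1 : K[X]).coeff 0 = -1 := by simp
  rw [NormCond, natDegree_X_sub_one, hcoeff, ← pow_add, hexp, norm_neg_one_pow, Ne,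
    mul_neg_one_pow_eq_one_iff]

theorem normCond_one_X_sub_one_iff [IsScalarTower K' K L] [FiniteDimensional K L]
    [IsGaloisGroup (Subgroup.zpowers σ) K L] (η : L) :
    NormCond K' σ 1 η (X - 1 : K[X]) ↔ Algebra.norm K' (-η) ≠ 1 := by
  have hneg : Algebra.norm K' (-1 : L) = (-1) ^ (orderOf σ * 1 * Module.finrank K' K) := by
    rw [← pow_one (-1 : L), norm_neg_one_pow, ← Module.finrank_mul_finrank K' K L,
      finrank_eq_orderOf σ]
    ring
  rw [normCond_X_sub_one_iff, neg_eq_neg_one_mul η, map_mul, hneg,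
    mul_comm (_ ^ _) (Algebra.norm K' η), Ne, Ne, mul_neg_one_pow_eq_one_iff]

end NormCond

section TwistedField

variable {K L : Type*} [Field K] [Field L] [Algebra K L]

theorem exists_algEquiv_over_fixedField (σ : L ≃ₐ[K] L) :
    ∃ (K₁ : IntermediateField K L) (τ : L ≃ₐ[K₁] L),
      (∀ a, τ a = σ a) ∧ ∀ a, τ a = a ↔ a ∈ K₁ := by
  let K₁ := IntermediateField.fixedField (Subgroup.zpowers σ)
  have hσ : σ ∈ K₁.fixingSubgroup :=
    (IntermediateField.le_iff_le _ _).mp le_rfl (Subgroup.mem_zpowers σ)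
  refine ⟨K₁, K₁.fixingSubgroupEquiv ⟨σ, hσ⟩, fun _ => rfl, fun a => ⟨fun h => ?_, fun h => ?_⟩⟩
  · rintro ⟨g, hg⟩
    have hle : Subgroup.zpowers σ ≤ MulAction.stabilizer (L ≃ₐ[K] L) a :=
      Subgroup.zpowers_le.mpr h
    exact hle hg
  · exact hσ ⟨a, h⟩

theorem exists_twistedField [FiniteDimensional K L] (σ ρ : L ≃ₐ[K] L) {c : L}
    (hc : Algebra.norm K c ≠ 1) :
    ∃ (K₁ : IntermediateField K L) (τ : L ≃ₐ[K₁] L),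
      (∀ a, τ a = σ a) ∧ (∀ a, τ a = a ↔ a ∈ K₁) ∧
      NormCond K τ 1 (-c) (X - 1 : K₁[X]) ∧
      ∃ Φ : RF τ (X - 1 : K₁[X]) ≃ₐ[K₁] Module.End K₁ L,
        IsLinearizedCorrespondence τ Φ ∧
        Φ '' codeS τ 1 (-c) ρ (X - 1) = spreadSetEnd K₁ (twistedMul ρ σ c) := by
  obtain ⟨K₁, τ, hτ, hfix⟩ := exists_algEquiv_over_fixedField σ
  have := isGaloisGroup_zpowers (σ := τ) fun a =>
    (hfix a).trans ⟨fun ha => ⟨⟨a, ha⟩, rfl⟩, by rintro ⟨x, rfl⟩; exact x.2⟩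
  refine ⟨K₁, τ, hτ, hfix, ?_, linearizedEquiv τ, isLinearizedCorrespondence_linearizedEquiv, ?_⟩
  · rwa [normCond_one_X_sub_one_iff, neg_neg]
  · rw [image_codeS_eq_twistedGabidulin _ one_pos, twistedGabidulin_one, neg_neg, funext hτ]

end TwistedField

end SkewMRD

end

theorem mainTheorem1 {K' K L : Type*} [Field K'] [Field K] [Field L]
    [Algebra K' K] [Algebra K L] [Algebra K' L] [IsScalarTower K' K L] [FiniteDimensional K' K]
    -- `K` is the fixed field of the automorphism `σ` of `L`, of finite order `n`
    (σ : L ≃ₐ[K] L) (hfix : ∀ a : L, σ a = a ↔ a ∈ Set.range (algebraMap K L))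
    (n : ℕ) (hn : orderOf σ = n) (hpos : 0 < n) (ρ : L ≃ₐ[K'] L) :
    -- the code is a `K'`-linear MRD code with minimum distance `n - k + 1`
    (∀ F : K[X], F.Monic → Irreducible F → ∀ k, 1 ≤ k → k ≤ n →
      ∀ η : L, SkewMRD.NormCond K' σ k η F →
      ∀ φ : SkewMRD.RF σ F ≃ₐ[K] Matrix (Fin n) (Fin n) (AdjoinRoot F),
        SkewMRD.IsLinearMRD K' (φ '' SkewMRD.codeS σ k η ρ F) (n - k + 1)) ∧
    -- over finite fields: the quotient is a matrix ring, and the size of the code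
    (Finite L → ∀ F : K[X], F.Monic → Irreducible F →
      (F ≠ X ∨ n = 1 → Nonempty (SkewMRD.RF σ F ≃ₐ[K] Matrix (Fin n) (Fin n) (AdjoinRoot F))) ∧
      ∀ k, 1 ≤ k → k ≤ n → ∀ η : L, SkewMRD.NormCond K' σ k η F →
        (SkewMRD.codeS σ k η ρ F).ncard = Nat.card K ^ (n * F.natDegree * k)) ∧
    -- `k = 1`: semifields
    (∀ F : K[X], F.Monic → Irreducible F → ∀ η : L, SkewMRD.NormCond K' σ 1 η F →
      ∀ φ : SkewMRD.RF σ F ≃ₐ[K] Matrix (Fin n) (Fin n) (AdjoinRoot F),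
        SkewMRD.DefinesSemifields K' (φ '' SkewMRD.codeS σ 1 η ρ F)) ∧
    -- `k = 1`, `η = 0`: the cyclic semifields
    (∀ F : K[X], F.Monic → Irreducible F → SkewMRD.NormCond K' σ 1 0 F ∧
      ∀ (f : SkewMRD.SkewPoly σ) (hf : SkewMRD.HasDegree f F.natDegree), Irreducible f →
      SkewMRD.evalXPow σ F ∈ Ideal.span {f} →
      ∀ φ : SkewMRD.RF σ F ≃ₐ[K] Matrix (Fin n) (Fin n) (AdjoinRoot F),
        SkewMRD.IsSpreadSetOf (φ '' SkewMRD.codeS σ 1 0 ρ F) (SkewMRD.petitMul hf)) ∧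
    -- over finite fields every cyclic semifield arises
    (Finite L → ∀ (s : ℕ) (f : SkewMRD.SkewPoly σ) (hf : SkewMRD.HasDegree f s), Irreducible f →
      ∃ F : K[X], F.Monic ∧ Irreducible F ∧ F.natDegree = s ∧ F ≠ X ∧
        ∀ φ : SkewMRD.RF σ F ≃ₐ[K] Matrix (Fin n) (Fin n) (AdjoinRoot F),
          SkewMRD.IsSpreadSetOf (φ '' SkewMRD.codeS σ 1 0 ρ F) (SkewMRD.petitMul hf)) ∧
    -- `s = 1`, `F = y - 1`: the twisted Gabidulin codes, and the generalised twisted fields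
    -- (`k = 1`) with the exponents `ρ` and `σ`
    (∃ Φ : SkewMRD.RF σ (X - 1 : K[X]) ≃ₐ[K] Module.End K L,
      SkewMRD.IsLinearizedCorrespondence σ Φ ∧
      (∀ k, 1 ≤ k → k ≤ n → ∀ η : L,
        Φ '' SkewMRD.codeS σ k η ρ (X - 1) = SkewMRD.twistedGabidulin σ k η ρ ∧
        (SkewMRD.NormCond K' σ k η (X - 1 : K[X]) ↔
          Algebra.norm K' η ≠ (-1) ^ (n * k * Module.finrank K' K))) ∧
      ∀ η : L,
        Φ '' SkewMRD.codeS σ 1 η ρ (X - 1) =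
          SkewMRD.spreadSetEnd K (SkewMRD.twistedMul ρ σ (-η)) ∧
        (SkewMRD.NormCond K' σ 1 η (X - 1 : K[X]) ↔ Algebra.norm K' (-η) ≠ 1)) ∧
    -- every generalised twisted field `a b - c a ^ (σ ^ i) b ^ (σ ^ j)` with `N(c) ≠ 1` arises,
    -- from the automorphism `τ = σ ^ j`, its fixed field `K₁`, and `ρ = σ ^ i`
    (∀ (i j : ℕ) (c : L), Algebra.norm K c ≠ 1 →
      ∃ (K₁ : IntermediateField K L) (τ : L ≃ₐ[K₁] L),
        (∀ a, τ a = (σ ^ j) a) ∧ (∀ a, τ a = a ↔ a ∈ K₁) ∧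
        SkewMRD.NormCond K τ 1 (-c) (X - 1 : K₁[X]) ∧
        ∃ Φ : SkewMRD.RF τ (X - 1 : K₁[X]) ≃ₐ[K₁] Module.End K₁ L,
          SkewMRD.IsLinearizedCorrespondence τ Φ ∧
          Φ '' SkewMRD.codeS τ 1 (-c) (σ ^ i) (X - 1) =
            SkewMRD.spreadSetEnd K₁ (SkewMRD.twistedMul (fun a => (σ ^ i) a) (fun a => (σ ^ j) a) c)) := by
  subst hn
  have := SkewMRD.isGaloisGroup_zpowers hfix
  have := SkewMRD.finiteDimensional_of_orderOf_pos σ hpos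
  have := FiniteDimensional.trans K' K L
  refine ⟨fun F hFm hF k hk1 hk η hc φ =>
      SkewMRD.isLinearMRD_codeS hFm hF (Nat.pos_iff_ne_zero.mp hk1) hk hc φ,
    fun _ F hFm hF => ⟨fun hX => ?_, fun k hk1 hk η hc =>
      SkewMRD.ncard_codeS hFm hk (Nat.mul_pos hk1 hF.natDegree_pos) hc⟩,
    fun F hFm hF η hc φ => SkewMRD.definesSemifields_codeS hFm hF hc φ,
    fun F hFm hF => ⟨SkewMRD.normCond_zero 1 F, fun f hf _ hFf φ =>
      SkewMRD.isSpreadSetOf_petitMul ρ hFm hF rfl hf hFf φ⟩,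
    fun _ s f hf hirr => SkewMRD.exists_isSpreadSetOf_petitMul ρ hf hirr,
    ⟨SkewMRD.linearizedEquiv σ, SkewMRD.isLinearizedCorrespondence_linearizedEquiv,
      fun k hk1 _ η => ⟨SkewMRD.image_codeS_eq_twistedGabidulin ρ hk1 η,
        SkewMRD.normCond_X_sub_one_iff k η⟩,
      fun η => ⟨(SkewMRD.image_codeS_eq_twistedGabidulin ρ one_pos η).trans
          (SkewMRD.twistedGabidulin_one ρ η),
        SkewMRD.normCond_one_X_sub_one_iff η⟩⟩,
    fun i j c hc => SkewMRD.exists_twistedField (σ ^ j) (σ ^ i) hc⟩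
  exact hX.elim (SkewMRD.nonempty_algEquiv_of_finite hFm hF)
    fun h1 => SkewMRD.nonempty_algEquiv_of_orderOf_eq_one h1 hFm hF
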